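/- Let $\mathbb K=\mathbb R$ or $\mathbb C$ and let $n\ge 1$ be an integer. For $M\in\mathbb K^{n\times(n+1)}$ let $\sigma_1(M)\ge\cdots\ge\sigma_n(M)\ge0$ be its singular values and $\|M\|_F$ its Frobenius norm. Let $\mathbb{GL}^{>}_{n,n+1}$ be the set of those $M$ with $\sigma_n(M)>0$ and $\sigma_{n-1}(M)>\sigma_n(M)$ (the second condition is void for $n=1$), i.e. of the matrices of rank $n$ whose smallest singular value is simple. Let $$\mathcal W^{>}=\left\{([M],[\zeta])\in\mathbb P(\mathbb K^{n\times(n+1)})\times\mathbb P_n(\mathbb K)\ :\ M\in\mathbb{GL}^{>}_{n,n+1},\ M\zeta=0\right\},$$ a submanifold, equipped with the Riemannian metric $\langle\cdot,\cdot\rangle$ induced by the product of the Fubini--Study metrics (those for which the projections of the unit spheres onto the projective spaces are Riemannian submersions, for the real inner products $\mathrm{Re}\langle\cdot,\cdot\rangle$). Then the function $$\alpha_2:\mathcal W^{>}\to\mathbb R,\qquad \alpha_2([M],[\zeta])=\frac{\|M\|_F^2}{\sigma_n(M)^2},$$ is self-convex: it is positive and of class $C^2$, and for every geodesic $\gamma$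 (defined on an interval) of $\mathcal W^{>}$ for the condition metric $\alpha_2\,\langle\cdot,\cdot\rangle$, the function $t\mapsto\log\alpha_2(\gamma(t))$ is convex. -/

import Mathlib

open scoped LinearAlgebra.Projectivization ContDiff Topology

noncomputable section

namespace CondMetric

section Projective

variable {𝕜 : Type*} [RCLike 𝕜] {ι : Type*} [Fintype ι]

/-- Maps of class `C^k` into the projective space of `𝕜^ι` (regarded as a real manifold): near
every point of `s` the map is `y ↦ [v y]` for a nowhere vanishing map `v` of class `C^k`. -/
def ContDiffOnProj {E : Type*} [NormedAddCommGroup E] [NormedSpace ℝ E] (k : WithTop ℕ∞)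
    (f : E → ℙ 𝕜 (EuclideanSpace 𝕜 ι)) (s : Set E) : Prop :=
  ∀ x ∈ s, ∃ U ∈ 𝓝 x, ∃ v : E → EuclideanSpace 𝕜 ι, ContDiffOn ℝ k v (s ∩ U) ∧
    ∀ y ∈ s ∩ U, ∃ hv : v y ≠ 0, f y = Projectivization.mk 𝕜 (v y) hv

/-- The Fubini--Study metric in homogeneous coordinates: the squared norm
`(‖v‖²‖w‖² - |⟪v, w⟫|²) / ‖v‖⁴` of the tangent vector of projective space at `[v]` that is
represented by `w`, i.e. of the image of `w` under the differential at `v` of `v ↦ [v]`. It is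
the metric for which the projection of the unit sphere is a Riemannian submersion. -/
def fubiniStudySq (v w : EuclideanSpace 𝕜 ι) : ℝ :=
  (‖v‖ ^ 2 * ‖w‖ ^ 2 - ‖inner 𝕜 v w‖ ^ 2) / ‖v‖ ^ 4

/-- The local lift of a curve `γ` in projective space whose inner product with a chosen
representative of `γ t` is `1`; it is defined at every `s` such that `γ s` is not orthogonal
to `γ t`. -/
def affineLift (γ : ℝ → ℙ 𝕜 (EuclideanSpace 𝕜 ι)) (t s : ℝ) : EuclideanSpace 𝕜 ι :=
  (inner 𝕜 (γ t).rep (γ s).rep)⁻¹ • (γ s).rep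

/-- The squared Fubini--Study speed `‖γ'(t)‖²` of a curve in projective space, computed with the
local lift above; `speedSq_eq` says that any other differentiable lift gives the same value. -/
def speedSq (γ : ℝ → ℙ 𝕜 (EuclideanSpace 𝕜 ι)) (t : ℝ) : ℝ :=
  fubiniStudySq (affineLift γ t t) (deriv (affineLift γ t) t)

theorem fubiniStudySq_lift (v w : EuclideanSpace 𝕜 ι) {c : 𝕜} (hc : c ≠ 0) (d : 𝕜) :
    fubiniStudySq (c • v) (c • w + d • v) = fubiniStudySq v w := by
  by_cases hv : v = 0
  · simp [fubiniStudySq, hv]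
  have hv' : ‖v‖ ≠ 0 := norm_ne_zero_iff.mpr hv
  have hc' : ‖c‖ ≠ 0 := norm_ne_zero_iff.mpr hc
  have h1 : ‖c • w + d • v‖ ^ 2 = ‖c‖ ^ 2 * ‖w‖ ^ 2
      + 2 * RCLike.re (d * starRingEnd 𝕜 c * starRingEnd 𝕜 (inner 𝕜 v w)) + ‖d‖ ^ 2 * ‖v‖ ^ 2 := by
    rw [@norm_add_sq 𝕜, norm_smul, norm_smul, inner_smul_left, inner_smul_right,
      ← inner_conj_symm w v]
    ring_nf
  have h2 : ‖inner 𝕜 (c • v) (c • w + d • v)‖ ^ 2 = ‖c‖ ^ 2 * (‖c‖ ^ 2 * ‖inner 𝕜 v w‖ ^ 2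
      + 2 * ‖v‖ ^ 2 * RCLike.re (d * starRingEnd 𝕜 c * starRingEnd 𝕜 (inner 𝕜 v w))
      + ‖d‖ ^ 2 * ‖v‖ ^ 4) := by
    rw [inner_smul_left, inner_add_right, inner_smul_right, inner_smul_right,
      inner_self_eq_norm_sq_to_K, norm_mul, mul_pow, RCLike.norm_conj]
    congr 1
    rw [← RCLike.normSq_eq_def', RCLike.normSq_add, RCLike.normSq_eq_def', RCLike.normSq_eq_def']
    have e : c * inner 𝕜 v w * starRingEnd 𝕜 (d * ((‖v‖ : ℝ) : 𝕜) ^ 2) =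
        ((‖v‖ ^ 2 : ℝ) : 𝕜) * starRingEnd 𝕜 (d * starRingEnd 𝕜 c * starRingEnd 𝕜 (inner 𝕜 v w)) := by
      simp only [map_mul, map_pow, RCLike.conj_ofReal, RCLike.conj_conj]
      ring
    rw [e, RCLike.re_ofReal_mul, RCLike.conj_re]
    simp only [norm_mul, norm_pow, RCLike.norm_ofReal, abs_norm]
    ring
  unfold fubiniStudySq
  rw [h1, h2, norm_smul]
  field_simp
  ring

/-- The squared speed may be computed with any differentiable lift of the curve. -/
theorem speedSq_eq (γ : ℝ → ℙ 𝕜 (EuclideanSpace 𝕜 ι)) (t : ℝ) (v : ℝ → EuclideanSpace 𝕜 ι)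
    (w : EuclideanSpace 𝕜 ι) (hv : HasDerivAt v w t)
    (hγ : ∀ᶠ s in 𝓝 t, ∃ h : v s ≠ 0, γ s = Projectivization.mk 𝕜 (v s) h) :
    speedSq γ t = fubiniStudySq (v t) w := by
  obtain ⟨h0, ht⟩ := hγ.self_of_nhds
  obtain ⟨a, ha⟩ := Projectivization.exists_smul_eq_mk_rep 𝕜 (v t) h0
  rw [← ht] at ha
  have key : ∀ᶠ s in 𝓝 t, affineLift γ t s = (inner 𝕜 (γ t).rep (v s))⁻¹ • v s := by
    filter_upwards [hγ] with s hs
    obtain ⟨hs0, hs⟩ := hs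
    obtain ⟨b, hb⟩ := Projectivization.exists_smul_eq_mk_rep 𝕜 (v s) hs0
    rw [← hs] at hb
    have hb0 : (b : 𝕜) ≠ 0 := b.ne_zero
    rw [affineLift, ← hb, Units.smul_def, inner_smul_right, smul_smul, mul_inv]
    congr 1
    field_simp
  have hI : inner 𝕜 (γ t).rep (v t) ≠ 0 := by
    rw [← ha, Units.smul_def, inner_smul_left]
    exact mul_ne_zero (by simp) (by simpa using h0)
  have hd : HasDerivAt (fun s => inner 𝕜 (γ t).rep (v s)) (inner 𝕜 (γ t).rep w) t := by
    simpa using (hasDerivAt_const t (γ t).rep).inner 𝕜 hv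
  have hd2 := (hd.inv hI).smul hv
  have hd3 := hd2.congr_of_eventuallyEq key
  rw [speedSq, hd3.deriv, key.self_of_nhds]
  exact fubiniStudySq_lift _ _ (inv_ne_zero hI) _

end Projective

section SelfConvex

variable {𝕜 : Type*} [RCLike 𝕜] {ι κ : Type*} [Fintype ι] [Fintype κ]

/-- Maps of class `C^k` into a product of two projective spaces. -/
def ContDiffOnProj₂ {E : Type*} [NormedAddCommGroup E] [NormedSpace ℝ E] (k : WithTop ℕ∞)
    (f : E → ℙ 𝕜 (EuclideanSpace 𝕜 ι) × ℙ 𝕜 (EuclideanSpace 𝕜 κ)) (s : Set E) : Prop :=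
  ContDiffOnProj k (fun x => (f x).1) s ∧ ContDiffOnProj k (fun x => (f x).2) s

/-- The energy `½ ∫ α(γ(t)) ‖γ'(t)‖² dt` on `[a, b]` of a curve in a product of two projective
spaces for the metric `α ⟨·,·⟩`, where `⟨·,·⟩` is the product of the Fubini--Study metrics. -/
def energy (α : ℙ 𝕜 (EuclideanSpace 𝕜 ι) × ℙ 𝕜 (EuclideanSpace 𝕜 κ) → ℝ)
    (γ : ℝ → ℙ 𝕜 (EuclideanSpace 𝕜 ι) × ℙ 𝕜 (EuclideanSpace 𝕜 κ)) (a b : ℝ) : ℝ :=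
  1 / 2 * ∫ t in a..b,
    α (γ t) * (speedSq (fun s => (γ s).1) t + speedSq (fun s => (γ s).2) t)

/-- `Γ s`, `|s| < δ`, is a `C²` variation within `W`, with fixed end points, of the curve `γ`
on `[a, b]`. -/
structure IsVariation (W : Set (ℙ 𝕜 (EuclideanSpace 𝕜 ι) × ℙ 𝕜 (EuclideanSpace 𝕜 κ)))
    (γ : ℝ → ℙ 𝕜 (EuclideanSpace 𝕜 ι) × ℙ 𝕜 (EuclideanSpace 𝕜 κ)) (a b δ : ℝ)
    (Γ : ℝ → ℝ → ℙ 𝕜 (EuclideanSpace 𝕜 ι) × ℙ 𝕜 (EuclideanSpace 𝕜 κ)) : Prop where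
  contDiff : ContDiffOnProj₂ 2 (fun p : ℝ × ℝ => Γ p.1 p.2) (Set.Ioo (-δ) δ ×ˢ Set.Icc a b)
  mem : ∀ s ∈ Set.Ioo (-δ) δ, ∀ t ∈ Set.Icc a b, Γ s t ∈ W
  zero : ∀ t ∈ Set.Icc a b, Γ 0 t = γ t
  left : ∀ s ∈ Set.Ioo (-δ) δ, Γ s a = γ a
  right : ∀ s ∈ Set.Ioo (-δ) δ, Γ s b = γ b

/-- `γ` is, on the interval `I`, a geodesic of the submanifold `W` of a product of two projective
spaces for the metric `α ⟨·,·⟩`, where `⟨·,·⟩` is the metric induced on `W` by the product of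
the Fubini--Study metrics: `γ` is a curve of class `C²` in `W`, and it is a critical point of the
energy, on each compact subinterval, under variations within `W` that fix the end points. -/
structure IsGeodesicOn (W : Set (ℙ 𝕜 (EuclideanSpace 𝕜 ι) × ℙ 𝕜 (EuclideanSpace 𝕜 κ)))
    (α : ℙ 𝕜 (EuclideanSpace 𝕜 ι) × ℙ 𝕜 (EuclideanSpace 𝕜 κ) → ℝ)
    (γ : ℝ → ℙ 𝕜 (EuclideanSpace 𝕜 ι) × ℙ 𝕜 (EuclideanSpace 𝕜 κ)) (I : Set ℝ) : Prop where
  interval : I.OrdConnected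
  contDiff : ContDiffOnProj₂ 2 γ I
  mem : ∀ t ∈ I, γ t ∈ W
  critical : ∀ a ∈ I, ∀ b ∈ I, a < b → ∀ δ > 0, ∀ Γ, IsVariation W γ a b δ Γ →
    HasDerivAt (fun s => energy α (Γ s) a b) 0 0

/-- Self-convexity of a function `α` on a submanifold `W` of a product of two projective spaces,
where `W` carries the metric `⟨·,·⟩` induced by the product of the Fubini--Study metrics: `α` is
of class `C²` and positive on `W`, and `log α` is convex along every geodesic of `W` for the
condition metric `α ⟨·,·⟩`. (That `α` is `C²` is tested on all `C²` maps from open subsets of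
real coordinate spaces to `W`, local parametrizations of `W` among them.) -/
structure IsSelfConvexOn (W : Set (ℙ 𝕜 (EuclideanSpace 𝕜 ι) × ℙ 𝕜 (EuclideanSpace 𝕜 κ)))
    (α : ℙ 𝕜 (EuclideanSpace 𝕜 ι) × ℙ 𝕜 (EuclideanSpace 𝕜 κ) → ℝ) : Prop where
  contDiff : ∀ (d : ℕ) (U : Set (EuclideanSpace ℝ (Fin d))), IsOpen U →
    ∀ φ : EuclideanSpace ℝ (Fin d) → ℙ 𝕜 (EuclideanSpace 𝕜 ι) × ℙ 𝕜 (EuclideanSpace 𝕜 κ),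
      ContDiffOnProj₂ 2 φ U → (∀ x ∈ U, φ x ∈ W) → ContDiffOn ℝ 2 (fun x => α (φ x)) U
  pos : ∀ p ∈ W, 0 < α p
  convex : ∀ (γ : ℝ → ℙ 𝕜 (EuclideanSpace 𝕜 ι) × ℙ 𝕜 (EuclideanSpace 𝕜 κ)) (I : Set ℝ),
    IsGeodesicOn W α γ I → ConvexOn ℝ I (fun t => Real.log (α (γ t)))

end SelfConvex

section SolutionVariety

variable {𝕜 : Type*} [RCLike 𝕜] {n : ℕ}

/-- The `n × (n+1)` matrices over `𝕜`, as vectors of entries: the norm is the Frobenius norm and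
the inner product is the Frobenius inner product. -/
abbrev Mat (𝕜 : Type*) (n : ℕ) : Type _ := EuclideanSpace 𝕜 (Fin n × Fin (n + 1))

/-- The matrix with the given entries. -/
def Mat.toMatrix (M : Mat 𝕜 n) : Matrix (Fin n) (Fin (n + 1)) 𝕜 :=
  Matrix.of fun i j => M (i, j)

/-- The linear map `𝕜^(n+1) → 𝕜^n`, `ζ ↦ M ζ`. -/
def Mat.toLin (M : Mat 𝕜 n) : EuclideanSpace 𝕜 (Fin (n + 1)) →ₗ[𝕜] EuclideanSpace 𝕜 (Fin n) :=
  Matrix.toEuclideanLin M.toMatrix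

/-- The singular value `σ_k(M)`, `1 ≤ k ≤ n`, where `σ_1(M) ≥ ⋯ ≥ σ_n(M) ≥ 0` (Mathlib counts
the singular values from `0`). -/
def Mat.sigma (M : Mat 𝕜 n) (k : ℕ) : ℝ := M.toLin.singularValues (k - 1)

/-- `σ_n(M) > 0`, and `σ_{n-1}(M) > σ_n(M)` where there is a `σ_{n-1}(M)`, i.e. if `n ≥ 2`:
`M` has rank `n` and its smallest singular value is simple. -/
def Mat.IsGLSimple (M : Mat 𝕜 n) : Prop :=
  0 < M.sigma n ∧ (2 ≤ n → M.sigma n < M.sigma (n - 1))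

variable (𝕜 n) in
/-- The projective solution variety: the pairs `([M], [ζ])` such that `M` has rank `n` and a simple
smallest singular value, and `M ζ = 0`. -/
def solutionVariety : Set (ℙ 𝕜 (Mat 𝕜 n) × ℙ 𝕜 (EuclideanSpace 𝕜 (Fin (n + 1)))) :=
  {p | ∃ (M : Mat 𝕜 n) (ζ : EuclideanSpace 𝕜 (Fin (n + 1))) (hM : M ≠ 0) (hζ : ζ ≠ 0),
    p = (Projectivization.mk 𝕜 M hM, Projectivization.mk 𝕜 ζ hζ) ∧ M.IsGLSimple ∧ M.toLin ζ = 0}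

theorem Mat.toLin_smul (t : 𝕜) (M : Mat 𝕜 n) : (t • M).toLin = t • M.toLin := by
  unfold Mat.toLin
  rw [← map_smul]
  congr 1

theorem eigenvalues_eq_of_charpoly {E : Type*} [NormedAddCommGroup E] [InnerProductSpace 𝕜 E]
    [FiniteDimensional 𝕜 E] {m : ℕ} {S : E →ₗ[𝕜] E} (hS : S.IsSymmetric)
    (hm : Module.finrank 𝕜 E = m) (f : Fin m → ℝ) (hf : Antitone f)
    (h : S.charpoly = ∏ i, (Polynomial.X - Polynomial.C (f i : 𝕜))) :
    hS.eigenvalues hm = f := by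
  have hr : S.charpoly.roots = Multiset.map (RCLike.ofReal ∘ f) Finset.univ.val := by
    rw [h, Polynomial.roots_prod _ _ (by
      simp [Finset.prod_ne_zero_iff, Polynomial.X_sub_C_ne_zero])]
    simp
  rw [← List.ofFn_inj, ← hS.sort_roots_charpoly_eq_eigenvalues]
  simp_rw [hr, Fin.univ_val_map, Multiset.map_coe, List.map_ofFn,
    Function.comp_def, RCLike.ofReal_re, Multiset.coe_sort]
  apply List.mergeSort_of_pairwise
  simp_rw [decide_eq_true_eq, ← List.sortedGE_iff_pairwise]
  exact hf.sortedGE_ofFn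

theorem singularValues_smul {E F : Type*} [NormedAddCommGroup E] [InnerProductSpace 𝕜 E]
    [FiniteDimensional 𝕜 E] [NormedAddCommGroup F] [InnerProductSpace 𝕜 F]
    [FiniteDimensional 𝕜 F] (T : E →ₗ[𝕜] F) (t : 𝕜) (i : ℕ) :
    (t • T).singularValues i = ‖t‖ * T.singularValues i := by
  by_cases hi : i < Module.finrank 𝕜 E
  · have hS := T.isSymmetric_adjoint_comp_self
    have hS' := (t • T).isSymmetric_adjoint_comp_self
    have e : (t • T).adjoint ∘ₗ (t • T) = ((‖t‖ ^ 2 : ℝ) : 𝕜) • (T.adjoint ∘ₗ T) := by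
      rw [map_smulₛₗ, LinearMap.smul_comp, LinearMap.comp_smul, smul_smul, RCLike.conj_mul]
      push_cast
      rfl
    have key : hS'.eigenvalues rfl = fun j => ‖t‖ ^ 2 * hS.eigenvalues rfl j := by
      apply eigenvalues_eq_of_charpoly
      · exact (hS.eigenvalues_antitone rfl).const_mul (by positivity)
      · rw [← LinearMap.charpoly_toMatrix _ (hS.eigenvectorBasis rfl).toBasis, e, map_smul,
          hS.toMatrix_eigenvectorBasis, ← Matrix.diagonal_smul, Matrix.charpoly_diagonal]
        simp
    rw [LinearMap.singularValues_of_lt _ rfl hi, LinearMap.singularValues_of_lt _ rfl hi,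
      congrFun key, Real.sqrt_mul (by positivity), Real.sqrt_sq (norm_nonneg t)]
  · rw [LinearMap.singularValues_of_finrank_le _ (not_lt.mp hi),
      LinearMap.singularValues_of_finrank_le _ (not_lt.mp hi), mul_zero]

variable (𝕜 n) in
/-- The squared condition number `([M], [ζ]) ↦ ‖M‖_F² / σ_n(M)²`. -/
def condSq (p : ℙ 𝕜 (Mat 𝕜 n) × ℙ 𝕜 (EuclideanSpace 𝕜 (Fin (n + 1)))) : ℝ :=
  Projectivization.lift (fun M : {M : Mat 𝕜 n // M ≠ 0} => ‖M.1‖ ^ 2 / M.1.sigma n ^ 2)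
    (by
      rintro ⟨M, hM⟩ ⟨N, hN⟩ t h
      obtain rfl : M = t • N := h
      have ht : ‖t‖ ≠ 0 := by
        rw [norm_ne_zero_iff]
        rintro rfl
        exact hM (zero_smul _ _)
      simp only [Mat.sigma, Mat.toLin_smul, singularValues_smul, norm_smul, mul_pow]
      exact mul_div_mul_left _ _ (pow_ne_zero 2 ht)) p.1

end SolutionVariety

end CondMetric

end

open scoped LinearAlgebra.Projectivization ContDiff Topology

noncomputable section

namespace CondMetric

/-! ### Matrices as linear maps, rank-one matrices and their inner products -/

section Linear

variable {𝕜 : Type*} [RCLike 𝕜] {n : ℕ}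

/-! Scale representatives so that σ_n(M) = 1 and split M = A + B, where v is the unit right singular
vector for σ_n, u = M v and A = u v*. Then A ⟂ B and ‖A‖ = 1, so α₂ = ‖M‖² = 1 + ‖B‖².

No geodesic equation is needed: one explicit variation suffices. On a short interval [a, b] put φ(t)
= (t - a)(b - t), replace M by A + exp(-sφ) B and keep ζ. For small |s| the gap above σ_n keeps this
curve in the variety with σ_n = 1. The energy density has s-derivative -2φQ - φ'(log α₂)' at s = 0,
up to the factor 1/2, with Q = ‖D‖² + Re⟨A', D⟩ + ‖B‖²‖ζ'‖², D = B' - κB for a suitable κ. If Q ≥ 0,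
criticality gives ∫ φ'(log α₂)' ≤ 0 on all short intervals, which forces (log α₂)'' ≥ 0
(`nonneg_of_integral_nonpos`).

That Q ≥ 0 is `IsMinSingular.second_variation_nonneg`. Differentiating B v = 0 and u*B = 0 gives D v
= -B v' and u*D = -u'*B. Hence Re⟨A', D⟩ = -2 Re⟨u', B v'⟩, while ‖D‖² ≥ ‖B v'‖² + ‖B*u'‖². Off v
and ζ, B does not shrink vectors, because σ_n = 1 is the smallest singular value; so the cross term
is at most 2‖B*u'‖‖B v'‖ in absolute value when it is negative.

Simplicity of σ_n makes v and σ_n² functions of class C² of M by the implicit function theorem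
(`IsMinSingular.exists_contDiffAt`). This gives C² lifts (`exists_isLift`) and the regularity of α₂.
-/

theorem Mat.toLin_apply (M : Mat 𝕜 n) (v : EuclideanSpace 𝕜 (Fin (n + 1))) (i : Fin n) :
    M.toLin v i = ∑ j, M (i, j) * v j := by
  simp [Mat.toLin, Mat.toMatrix, Matrix.toLpLin_apply, Matrix.mulVec, dotProduct]

theorem Mat.toLin_add (M N : Mat 𝕜 n) : (M + N).toLin = M.toLin + N.toLin := by
  ext v i
  simp [Mat.toLin_apply, add_mul, Finset.sum_add_distrib]

theorem Mat.toLin_sub (M N : Mat 𝕜 n) : (M - N).toLin = M.toLin - N.toLin := by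
  ext v i
  simp [Mat.toLin_apply, sub_mul, Finset.sum_sub_distrib]

theorem Mat.toLin_real_smul (r : ℝ) (M : Mat 𝕜 n) (v : EuclideanSpace 𝕜 (Fin (n + 1))) :
    (r • M).toLin v = r • M.toLin v := by
  ext i
  simp [Mat.toLin_apply, Finset.smul_sum]

/-- The matrix `x y*`. -/
def outer (x : EuclideanSpace 𝕜 (Fin n)) (y : EuclideanSpace 𝕜 (Fin (n + 1))) : Mat 𝕜 n :=
  WithLp.toLp 2 fun p => x p.1 * starRingEnd 𝕜 (y p.2)

theorem outer_apply (x : EuclideanSpace 𝕜 (Fin n)) (y : EuclideanSpace 𝕜 (Fin (n + 1)))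
    (p : Fin n × Fin (n + 1)) : outer x y p = x p.1 * starRingEnd 𝕜 (y p.2) := rfl

theorem inner_outer (x : EuclideanSpace 𝕜 (Fin n)) (y : EuclideanSpace 𝕜 (Fin (n + 1)))
    (M : Mat 𝕜 n) : inner 𝕜 (outer x y) M = inner 𝕜 x (M.toLin y) := by
  simp only [PiLp.inner_apply, outer_apply, RCLike.inner_apply, Mat.toLin_apply,
    Fintype.sum_prod_type, map_mul, RCLike.conj_conj, Finset.sum_mul]
  exact Finset.sum_congr rfl fun i _ => Finset.sum_congr rfl fun j _ => by ring

theorem toLin_outer (x : EuclideanSpace 𝕜 (Fin n)) (y w : EuclideanSpace 𝕜 (Fin (n + 1))) :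
    (outer x y).toLin w = inner 𝕜 y w • x := by
  ext i
  simp only [Mat.toLin_apply, outer_apply, PiLp.smul_apply, PiLp.inner_apply, RCLike.inner_apply,
    smul_eq_mul, Finset.sum_mul]
  exact Finset.sum_congr rfl fun j _ => by ring

theorem norm_outer_sq (x : EuclideanSpace 𝕜 (Fin n)) (y : EuclideanSpace 𝕜 (Fin (n + 1))) :
    ‖outer x y‖ ^ 2 = ‖x‖ ^ 2 * ‖y‖ ^ 2 := by
  have h : ((‖outer x y‖ ^ 2 : ℝ) : 𝕜) = ((‖x‖ ^ 2 * ‖y‖ ^ 2 : ℝ) : 𝕜) := by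
    push_cast
    rw [← inner_self_eq_norm_sq_to_K, inner_outer, toLin_outer, inner_smul_right,
      inner_self_eq_norm_sq_to_K, inner_self_eq_norm_sq_to_K, mul_comm]
  exact_mod_cast h

variable (𝕜 n) in
/-- The evaluation `(M, v) ↦ M v` as a continuous real bilinear map. -/
def evalL : Mat 𝕜 n →L[ℝ] EuclideanSpace 𝕜 (Fin (n + 1)) →L[ℝ] EuclideanSpace 𝕜 (Fin n) :=
  (LinearMap.mk₂ ℝ (fun M v => M.toLin v)
    (fun M N v => by simp [Mat.toLin_add])
    (fun r M v => Mat.toLin_real_smul r M v)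
    (fun M v w => map_add _ _ _)
    (fun r M v => by ext i; simp [Mat.toLin_apply, Finset.smul_sum])).toContinuousBilinearMap

@[simp] theorem evalL_apply (M : Mat 𝕜 n) (v : EuclideanSpace 𝕜 (Fin (n + 1))) :
    evalL 𝕜 n M v = M.toLin v := rfl

variable (𝕜 n) in
/-- The map `(x, y) ↦ x y*` as a continuous real bilinear map. -/
def outerL : EuclideanSpace 𝕜 (Fin n) →L[ℝ] EuclideanSpace 𝕜 (Fin (n + 1)) →L[ℝ] Mat 𝕜 n :=
  (LinearMap.mk₂ ℝ (fun x y => outer x y)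
    (fun x y z => by ext p; simp [outer_apply, add_mul])
    (fun r x y => by ext p; simp [outer_apply])
    (fun x y z => by ext p; simp [outer_apply, mul_add])
    (fun r x y => by ext p; simp [outer_apply, RCLike.real_smul_eq_coe_mul]; ring)
    ).toContinuousBilinearMap

@[simp] theorem outerL_apply (x : EuclideanSpace 𝕜 (Fin n))
    (y : EuclideanSpace 𝕜 (Fin (n + 1))) : outerL 𝕜 n x y = outer x y := rfl

theorem hasDerivAt_toLin {M : ℝ → Mat 𝕜 n} {v : ℝ → EuclideanSpace 𝕜 (Fin (n + 1))}
    {M' : Mat 𝕜 n} {v' : EuclideanSpace 𝕜 (Fin (n + 1))} {t : ℝ} (hM : HasDerivAt M M' t)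
    (hv : HasDerivAt v v' t) :
    HasDerivAt (fun s => (M s).toLin (v s)) (M'.toLin (v t) + (M t).toLin v') t := by
  refine (((evalL 𝕜 n).isBoundedBilinearMap.hasFDerivAt (M t, v t)).comp_hasDerivAt t
    (hM.prodMk hv)).congr_deriv ?_
  simp [add_comm]

theorem hasDerivAt_outer {x : ℝ → EuclideanSpace 𝕜 (Fin n)}
    {y : ℝ → EuclideanSpace 𝕜 (Fin (n + 1))} {x' : EuclideanSpace 𝕜 (Fin n)}
    {y' : EuclideanSpace 𝕜 (Fin (n + 1))} {t : ℝ} (hx : HasDerivAt x x' t)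
    (hy : HasDerivAt y y' t) :
    HasDerivAt (fun s => outer (x s) (y s)) (outer x' (y t) + outer (x t) y') t := by
  refine (((outerL 𝕜 n).isBoundedBilinearMap.hasFDerivAt (x t, y t)).comp_hasDerivAt t
    (hx.prodMk hy)).congr_deriv ?_
  simp [add_comm]

theorem _root_.ContDiffOn.toLin {V : Type*} [NormedAddCommGroup V] [NormedSpace ℝ V]
    {k : WithTop ℕ∞} {s : Set V} {M : V → Mat 𝕜 n} {v : V → EuclideanSpace 𝕜 (Fin (n + 1))}
    (hM : ContDiffOn ℝ k M s) (hv : ContDiffOn ℝ k v s) :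
    ContDiffOn ℝ k (fun x => (M x).toLin (v x)) s :=
  (((evalL 𝕜 n).contDiff.comp_contDiffOn hM).clm_apply hv :)

theorem _root_.ContDiffOn.outer {V : Type*} [NormedAddCommGroup V] [NormedSpace ℝ V]
    {k : WithTop ℕ∞} {s : Set V} {x : V → EuclideanSpace 𝕜 (Fin n)}
    {y : V → EuclideanSpace 𝕜 (Fin (n + 1))}
    (hx : ContDiffOn ℝ k x s) (hy : ContDiffOn ℝ k y s) :
    ContDiffOn ℝ k (fun p => CondMetric.outer (x p) (y p)) s :=
  (((outerL 𝕜 n).contDiff.comp_contDiffOn hx).clm_apply hy :)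

/-- `v` is a unit right singular vector of `M` for the singular value `√l`, `ζ` spans the kernel,
and `‖M w‖² ≥ m ‖w‖²` on the orthogonal complement of `v` and `ζ`, where `m > l > 0`. -/
structure IsMinSingular (M : Mat 𝕜 n) (v ζ : EuclideanSpace 𝕜 (Fin (n + 1))) (l m : ℝ) :
    Prop where
  pos : 0 < l
  lt : l < m
  norm_eq : ‖v‖ = 1
  ne : ζ ≠ 0
  ker : M.toLin ζ = 0
  eig : ∀ w, inner 𝕜 (M.toLin v) (M.toLin w) = (l : 𝕜) * inner 𝕜 v w
  bound : ∀ w, inner 𝕜 v w = 0 → inner 𝕜 ζ w = 0 → m * ‖w‖ ^ 2 ≤ ‖M.toLin w‖ ^ 2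

/-- Testing the eigenvector identity on the kernel vector ζ kills its left side, and l ≠ 0. -/
theorem IsMinSingular.inner_eq_zero {M : Mat 𝕜 n} {v ζ : EuclideanSpace 𝕜 (Fin (n + 1))}
    {l m : ℝ} (h : IsMinSingular M v ζ l m) : inner 𝕜 v ζ = 0 := by
  have h1 := h.eig ζ
  rw [h.ker, inner_zero_right] at h1
  have := h.pos.ne'
  simpa [this] using h1.symm

theorem IsMinSingular.norm_sq {M : Mat 𝕜 n} {v ζ : EuclideanSpace 𝕜 (Fin (n + 1))}
    {l m : ℝ} (h : IsMinSingular M v ζ l m) : ‖M.toLin v‖ ^ 2 = l := by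
  have h1 := h.eig v
  rw [inner_self_eq_norm_sq_to_K, inner_self_eq_norm_sq_to_K, h.norm_eq] at h1
  have h2 : ((‖M.toLin v‖ ^ 2 : ℝ) : 𝕜) = ((l : ℝ) : 𝕜) := by simpa using h1
  exact_mod_cast h2

end Linear

/-! ### Ordered singular values and the characterization of the smallest one -/

section SingularValues

variable {𝕜 : Type*} [RCLike 𝕜] {n : ℕ}

theorem Mat.finrank_source :
    Module.finrank 𝕜 (EuclideanSpace 𝕜 (Fin (n + 1))) = n + 1 := by simp

/-- The eigenvalues of `M* M`, in decreasing order. -/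
def Mat.eig (M : Mat 𝕜 n) : Fin (n + 1) → ℝ :=
  M.toLin.isSymmetric_adjoint_comp_self.eigenvalues Mat.finrank_source

/-- An orthonormal basis of right singular vectors of `M`. -/
def Mat.eigBasis (M : Mat 𝕜 n) :
    OrthonormalBasis (Fin (n + 1)) 𝕜 (EuclideanSpace 𝕜 (Fin (n + 1))) :=
  M.toLin.isSymmetric_adjoint_comp_self.eigenvectorBasis Mat.finrank_source

theorem Mat.eig_antitone (M : Mat 𝕜 n) : Antitone M.eig :=
  M.toLin.isSymmetric_adjoint_comp_self.eigenvalues_antitone Mat.finrank_source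

theorem Mat.eig_nonneg (M : Mat 𝕜 n) (i : Fin (n + 1)) : 0 ≤ M.eig i :=
  M.toLin.isPositive_adjoint_comp_self.nonneg_eigenvalues Mat.finrank_source i

/-- `sigma` counts from 1 and `eig` from 0: σ_n² sits at index n - 1 of `eig`, and the last index n
belongs to the kernel. -/
theorem Mat.sigma_sq (M : Mat 𝕜 n) {k : ℕ} (hk : k < n + 1) :
    M.sigma (k + 1) ^ 2 = M.eig ⟨k, hk⟩ :=
  M.toLin.sq_singularValues_fin Mat.finrank_source ⟨k, hk⟩

theorem Mat.sigma_nonneg (M : Mat 𝕜 n) (k : ℕ) : 0 ≤ M.sigma k :=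
  M.toLin.singularValues_nonneg _

theorem Mat.inner_eigBasis (M : Mat 𝕜 n) (i : Fin (n + 1))
    (w : EuclideanSpace 𝕜 (Fin (n + 1))) :
    inner 𝕜 (M.toLin (M.eigBasis i)) (M.toLin w) = (M.eig i : 𝕜) * inner 𝕜 (M.eigBasis i) w := by
  have h := M.toLin.isSymmetric_adjoint_comp_self.apply_eigenvectorBasis Mat.finrank_source i
  rw [← LinearMap.adjoint_inner_left, ← LinearMap.comp_apply]
  exact (congrArg (fun x => inner 𝕜 x w) h).trans (by
    rw [inner_smul_left, RCLike.conj_ofReal]; rfl)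

theorem Mat.norm_toLin_sq (M : Mat 𝕜 n) (w : EuclideanSpace 𝕜 (Fin (n + 1))) :
    ‖M.toLin w‖ ^ 2 = ∑ i, M.eig i * ‖inner 𝕜 (M.eigBasis i) w‖ ^ 2 := by
  have h : ((‖M.toLin w‖ ^ 2 : ℝ) : 𝕜)
      = ((∑ i, M.eig i * ‖inner 𝕜 (M.eigBasis i) w‖ ^ 2 : ℝ) : 𝕜) := by
    push_cast
    rw [← inner_self_eq_norm_sq_to_K]
    have h : M.toLin w = ∑ i, M.eigBasis.repr w i • M.toLin (M.eigBasis i) := by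
      conv_lhs => rw [← M.eigBasis.sum_repr w, map_sum]
      simp only [map_smul]
    conv_lhs => rw [h, sum_inner, ← h]
    refine Finset.sum_congr rfl fun i _ => ?_
    rw [inner_smul_left, M.inner_eigBasis, M.eigBasis.repr_apply_apply,
      ← RCLike.conj_mul]
    ring
  exact_mod_cast h

theorem inner_eq_zero_of_eig_ne {M : Mat 𝕜 n} {x y : EuclideanSpace 𝕜 (Fin (n + 1))} {a b : ℝ}
    (hx : ∀ w, inner 𝕜 (M.toLin x) (M.toLin w) = (a : 𝕜) * inner 𝕜 x w)
    (hy : ∀ w, inner 𝕜 (M.toLin y) (M.toLin w) = (b : 𝕜) * inner 𝕜 y w) (hab : a ≠ b) :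
    inner 𝕜 x y = 0 := by
  have h1 := hx y
  have h2 := hy x
  rw [← inner_conj_symm, h2, map_mul, RCLike.conj_ofReal, inner_conj_symm] at h1
  have h3 : ((b : 𝕜) - a) * inner 𝕜 x y = 0 := by rw [sub_mul, h1, sub_self]
  rcases mul_eq_zero.1 h3 with h | h
  · exact absurd (by exact_mod_cast (sub_eq_zero.1 h).symm) hab
  · exact h

/-- Otherwise x would be orthogonal to every vector of the eigenbasis. -/
theorem Mat.exists_eig_eq {M : Mat 𝕜 n} {x : EuclideanSpace 𝕜 (Fin (n + 1))} {a : ℝ}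
    (hx : ∀ w, inner 𝕜 (M.toLin x) (M.toLin w) = (a : 𝕜) * inner 𝕜 x w) (h0 : x ≠ 0) :
    ∃ i, M.eig i = a := by
  by_contra! h
  apply h0
  rw [← M.eigBasis.sum_repr x]
  refine Finset.sum_eq_zero fun i _ => ?_
  rw [M.eigBasis.repr_apply_apply, inner_eq_zero_of_eig_ne (M.inner_eigBasis i) hx (h i), zero_smul]

variable {M : Mat 𝕜 n} {v ζ : EuclideanSpace 𝕜 (Fin (n + 1))} {l m : ℝ}

theorem IsMinSingular.eig_ker (h : IsMinSingular M v ζ l m) (w) :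
    inner 𝕜 (M.toLin ζ) (M.toLin w) = ((0 : ℝ) : 𝕜) * inner 𝕜 ζ w := by
  simp [h.ker]

/-- Eigenvectors of `M* M` for an eigenvalue `a < m` lie in the span of `x ∈ {v, ζ}`. -/
theorem IsMinSingular.eq_smul (h : IsMinSingular M v ζ l m)
    {x e : EuclideanSpace 𝕜 (Fin (n + 1))} {a : ℝ} (ha : a < m)
    (hx0 : x ≠ 0) (hx : ∀ w, inner 𝕜 (M.toLin x) (M.toLin w) = (a : 𝕜) * inner 𝕜 x w)
    (he : ∀ w, inner 𝕜 (M.toLin e) (M.toLin w) = (a : 𝕜) * inner 𝕜 e w)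
    (hv : v = x ∨ inner 𝕜 v e = 0 ∧ inner 𝕜 v x = 0)
    (hζ : ζ = x ∨ inner 𝕜 ζ e = 0 ∧ inner 𝕜 ζ x = 0) :
    ∃ c : 𝕜, e = c • x := by
  set c : 𝕜 := inner 𝕜 x e / inner 𝕜 x x with hc
  have hxx : inner 𝕜 x x ≠ 0 := by simpa using hx0
  refine ⟨c, sub_eq_zero.1 ?_⟩
  -- The part of e orthogonal to x is orthogonal to both v and ζ, and ‖M w‖² = a‖w‖² with a < m, so
  -- `bound` forces w = 0.
  set w := e - c • x with hw
  have hxw : inner 𝕜 x w = 0 := by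
    rw [hw, inner_sub_right, inner_smul_right, hc, div_mul_cancel₀ _ hxx, sub_self]
  have hvw : inner 𝕜 v w = 0 := by
    rcases hv with rfl | ⟨h1, h2⟩
    · exact hxw
    · rw [hw, inner_sub_right, inner_smul_right, h1, h2, mul_zero, sub_zero]
  have hζw : inner 𝕜 ζ w = 0 := by
    rcases hζ with rfl | ⟨h1, h2⟩
    · exact hxw
    · rw [hw, inner_sub_right, inner_smul_right, h1, h2, mul_zero, sub_zero]
  have hww : inner 𝕜 (M.toLin w) (M.toLin w) = (a : 𝕜) * inner 𝕜 w w := by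
    have h1 : inner 𝕜 (M.toLin w) (M.toLin w) =
        inner 𝕜 (M.toLin e - c • M.toLin x) (M.toLin w) := by rw [← map_smul, ← map_sub]
    have h2 : inner 𝕜 w w = inner 𝕜 (e - c • x) w := rfl
    rw [h1, h2, inner_sub_left, inner_smul_left, inner_sub_left, inner_smul_left, he, hx]
    ring
  have h1 : ‖M.toLin w‖ ^ 2 = a * ‖w‖ ^ 2 := by
    rw [inner_self_eq_norm_sq_to_K, inner_self_eq_norm_sq_to_K] at hww
    exact_mod_cast hww
  have h2 := h.bound w hvw hζw
  rw [h1] at h2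
  have h3 : ‖w‖ ^ 2 = 0 := by nlinarith [sq_nonneg ‖w‖]
  simpa using h3

theorem IsMinSingular.v_ne (h : IsMinSingular M v ζ l m) : v ≠ 0 := by
  rintro rfl
  simpa using h.norm_eq

/-- Two basis vectors sharing the eigenvalue 0 (or l) would both be multiples of ζ (or of v),
against orthonormality. -/
theorem IsMinSingular.unique_eig (h : IsMinSingular M v ζ l m) {i j : Fin (n + 1)}
    (hij : M.eig i = M.eig j) (hi : M.eig i = 0 ∨ M.eig i = l) : i = j := by
  have hζv : inner 𝕜 ζ v = 0 := inner_eq_zero_symm.1 h.inner_eq_zero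
  by_contra hne
  obtain ⟨x, c, d, h1, h2⟩ : ∃ x, ∃ c d : 𝕜, M.eigBasis i = c • x ∧ M.eigBasis j = d • x := by
    rcases hi with hi | hi
    · have key : ∀ k, M.eig k = 0 → ∃ c : 𝕜, M.eigBasis k = c • ζ := fun k hk =>
        h.eq_smul (h.pos.trans h.lt) h.ne h.eig_ker (fun w => by rw [M.inner_eigBasis, hk])
          (Or.inr ⟨inner_eq_zero_of_eig_ne h.eig (M.inner_eigBasis k) (by rw [hk]; exact h.pos.ne'),
            h.inner_eq_zero⟩) (Or.inl rfl)
      obtain ⟨c, hc⟩ := key i hi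
      obtain ⟨d, hd⟩ := key j (hij ▸ hi)
      exact ⟨ζ, c, d, hc, hd⟩
    · have key : ∀ k, M.eig k = l → ∃ c : 𝕜, M.eigBasis k = c • v := fun k hk =>
        h.eq_smul h.lt h.v_ne h.eig (fun w => by rw [M.inner_eigBasis, hk]) (Or.inl rfl)
          (Or.inr ⟨inner_eq_zero_of_eig_ne h.eig_ker (M.inner_eigBasis k)
            (by rw [hk]; exact h.pos.ne), hζv⟩)
      obtain ⟨c, hc⟩ := key i hi
      obtain ⟨d, hd⟩ := key j (hij ▸ hi)
      exact ⟨v, c, d, hc, hd⟩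
  have h3 := M.eigBasis.orthonormal.inner_eq_zero hne
  have hi0 := M.eigBasis.orthonormal.ne_zero i
  have hj0 := M.eigBasis.orthonormal.ne_zero j
  rw [h1] at hi0
  rw [h2] at hj0
  rw [h1, h2, inner_smul_left, inner_smul_right] at h3
  simp only [ne_eq, smul_eq_zero, not_or] at hi0 hj0
  simp [hi0.1, hj0.1, hi0.2] at h3

theorem IsMinSingular.le_eig (h : IsMinSingular M v ζ l m) {i : Fin (n + 1)}
    (h0 : M.eig i ≠ 0) (h1 : M.eig i ≠ l) : m ≤ M.eig i := by
  have h2 := h.bound (M.eigBasis i)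
    (inner_eq_zero_of_eig_ne h.eig (M.inner_eigBasis i) h1.symm)
    (inner_eq_zero_of_eig_ne h.eig_ker (M.inner_eigBasis i) h0.symm)
  have h3 : ‖M.toLin (M.eigBasis i)‖ ^ 2 = M.eig i := by
    have := M.inner_eigBasis i (M.eigBasis i)
    rw [inner_self_eq_norm_sq_to_K, inner_self_eq_norm_sq_to_K,
      M.eigBasis.orthonormal.norm_eq_one] at this
    have h4 : ((‖M.toLin (M.eigBasis i)‖ ^ 2 : ℝ) : 𝕜) = ((M.eig i : ℝ) : 𝕜) := by simpa using this
    exact_mod_cast h4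
  simpa [h3, M.eigBasis.orthonormal.norm_eq_one] using h2

/-- Locates l, so far known only through an eigenvector, in the ordered list: 0 and l occur once
each and all other eigenvalues are at least m > l, so 0 comes last and l just before it. -/
theorem IsMinSingular.sigma_sq_eq (h : IsMinSingular M v ζ l m) (hn : 1 ≤ n) :
    M.sigma n ^ 2 = l ∧ (2 ≤ n → m ≤ M.sigma (n - 1) ^ 2) := by
  obtain ⟨i, hi⟩ := M.exists_eig_eq h.eig_ker h.ne
  obtain ⟨k, hk⟩ := M.exists_eig_eq h.eig h.v_ne
  have hlast : M.eig (Fin.last n) = 0 :=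
    le_antisymm (hi ▸ M.eig_antitone (Fin.le_last i)) (M.eig_nonneg _)
  have hpos : ∀ j, j ≠ Fin.last n → M.eig j ≠ 0 := fun j hj h0 =>
    hj (h.unique_eig (h0.trans hlast.symm) (Or.inl h0))
  obtain ⟨q, rfl⟩ : ∃ q, n = q + 1 := ⟨n - 1, by omega⟩
  have hq : M.eig ⟨q, by omega⟩ = l := by
    -- Otherwise position q carries at least m; but l occurs at some index k ≤ q, where monotonicity
    -- would make it at least m too.
    by_contra hne
    have h1 := h.le_eig (hpos ⟨q, by omega⟩ (by simp [Fin.ext_iff])) hne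
    have hkn : k ≠ Fin.last (q + 1) := by
      rintro rfl
      rw [hlast] at hk
      exact h.pos.ne hk
    have hkq : k ≤ ⟨q, by omega⟩ := by
      rw [Fin.le_def]
      have := Fin.val_lt_last hkn
      simp only
      omega
    have h2 := M.eig_antitone hkq
    have := h.lt
    linarith
  refine ⟨by rw [M.sigma_sq (by omega), hq], fun h2 => ?_⟩
  obtain ⟨p, rfl⟩ : ∃ p, q = p + 1 := ⟨q - 1, by omega⟩
  rw [show p + 1 + 1 - 1 = p + 1 by omega, M.sigma_sq (by omega)]
  refine h.le_eig (hpos _ (by simp [Fin.ext_iff]; omega)) fun h3 => ?_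
  have := h.unique_eig (h3.trans hq.symm) (Or.inr h3)
  simp [Fin.ext_iff] at this

theorem IsMinSingular.isGLSimple (h : IsMinSingular M v ζ l m) (hn : 1 ≤ n) : M.IsGLSimple := by
  obtain ⟨h1, h2⟩ := h.sigma_sq_eq hn
  refine ⟨lt_of_le_of_ne (M.sigma_nonneg n) fun h0 => ?_, fun hn2 => ?_⟩
  · rw [← h0] at h1
    have := h.pos
    norm_num at h1
    linarith
  · refine lt_of_pow_lt_pow_left₀ 2 (M.sigma_nonneg _) ?_
    rw [h1]
    exact h.lt.trans_le (h2 hn2)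

theorem Mat.IsGLSimple.exists_isMinSingular (h : M.IsGLSimple) (hn : 1 ≤ n) (hζ : ζ ≠ 0)
    (hM : M.toLin ζ = 0) : ∃ v l m, IsMinSingular M v ζ l m := by
  obtain ⟨q, rfl⟩ : ∃ q, n = q + 1 := ⟨n - 1, by omega⟩
  obtain ⟨hpos, hlt⟩ := h
  set k : Fin (q + 1 + 1) := ⟨q, by omega⟩ with hk
  have hl : 0 < M.eig k := by rw [← M.sigma_sq]; positivity
  have hζj : ∀ j, j ≠ Fin.last (q + 1) → inner 𝕜 (M.eigBasis j) ζ = 0 := fun j hj =>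
    inner_eq_zero_of_eig_ne (M.inner_eigBasis j) (b := 0) (fun w => by simp [hM]) (by
      refine (hl.trans_le (M.eig_antitone ?_)).ne'
      rw [Fin.le_def]
      have := Fin.val_lt_last hj
      simp only [hk]
      omega)
  -- All other eigenvalues are positive, so ζ is a multiple of the last basis vector.
  have hζe : ζ = inner 𝕜 (M.eigBasis (Fin.last (q + 1))) ζ • M.eigBasis (Fin.last (q + 1)) := by
    conv_lhs => rw [← M.eigBasis.sum_repr ζ]
    rw [Finset.sum_eq_single (Fin.last (q + 1))]
    · rw [M.eigBasis.repr_apply_apply]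
    · intro j _ hj
      rw [M.eigBasis.repr_apply_apply, hζj j hj, zero_smul]
    · simp
  have hlastw : ∀ w, inner 𝕜 ζ w = 0 → inner 𝕜 (M.eigBasis (Fin.last (q + 1))) w = 0 := by
    intro w hw
    rw [hζe, inner_smul_left] at hw
    refine (mul_eq_zero.1 hw).resolve_left fun h0 => hζ ?_
    rw [hζe, (map_eq_zero _).1 h0, zero_smul]
  obtain ⟨m, hm, hmj⟩ : ∃ m, M.eig k < m ∧ ∀ j, j < k → m ≤ M.eig j := by
    rcases Nat.eq_zero_or_pos q with rfl | hq
    -- For n = 1 no further singular value exists, so any m above the eigenvalue serves; for n ≥ 2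
    -- the choice is σ_{n-1}².
    · refine ⟨M.eig k + 1, by linarith, fun j hj => ?_⟩
      rw [Fin.lt_def] at hj
      simp [hk] at hj
    · obtain ⟨p, rfl⟩ : ∃ p, q = p + 1 := ⟨q - 1, by omega⟩
      refine ⟨M.eig ⟨p, by omega⟩, ?_, fun j hj => M.eig_antitone ?_⟩
      · rw [hk, ← M.sigma_sq, ← M.sigma_sq]
        have := hlt (by omega)
        simp only [show p + 1 + 1 - 1 = p + 1 by omega] at this
        exact pow_lt_pow_left₀ this (M.sigma_nonneg _) two_ne_zero
      · rw [Fin.lt_def] at hj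
        rw [Fin.le_def]
        simp only [hk] at hj ⊢
        omega
  refine ⟨M.eigBasis k, M.eig k, m, hl, hm, M.eigBasis.orthonormal.norm_eq_one k, hζ, hM,
    M.inner_eigBasis k, fun w hw hw' => ?_⟩
  rw [M.norm_toLin_sq, ← M.eigBasis.sum_sq_norm_inner_right, Finset.mul_sum]
  refine Finset.sum_le_sum fun j _ => ?_
  rcases lt_trichotomy j k with hj | rfl | hj
  · exact mul_le_mul_of_nonneg_right (hmj j hj) (by positivity)
  · simp [hw]
  · have : j = Fin.last (q + 1) := by
      rw [Fin.ext_iff, Fin.val_last]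
      rw [Fin.lt_def] at hj
      have := j.is_lt
      simp only [hk] at hj
      omega
    rw [this, hlastw w hw']
    simp

end SingularValues

/-! ### Smooth dependence of the simple smallest singular value and its vector -/

section Smooth

variable {𝕜 : Type*} [RCLike 𝕜] {n : ℕ}

/-- The adjoint `M* x`. -/
def Mat.adj (M : Mat 𝕜 n) (x : EuclideanSpace 𝕜 (Fin n)) : EuclideanSpace 𝕜 (Fin (n + 1)) :=
  WithLp.toLp 2 fun j => ∑ i, starRingEnd 𝕜 (M (i, j)) * x i

theorem Mat.adj_apply (M : Mat 𝕜 n) (x : EuclideanSpace 𝕜 (Fin n)) (j : Fin (n + 1)) :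
    M.adj x j = ∑ i, starRingEnd 𝕜 (M (i, j)) * x i := rfl

theorem Mat.inner_adj (M : Mat 𝕜 n) (x : EuclideanSpace 𝕜 (Fin n))
    (w : EuclideanSpace 𝕜 (Fin (n + 1))) :
    inner 𝕜 (M.adj x) w = inner 𝕜 x (M.toLin w) := by
  simp only [PiLp.inner_apply, RCLike.inner_apply, Mat.toLin_apply, Mat.adj_apply, map_sum,
    map_mul, RCLike.conj_conj, Finset.sum_mul, Finset.mul_sum]
  rw [Finset.sum_comm]
  exact Finset.sum_congr rfl fun i _ => Finset.sum_congr rfl fun j _ => by ring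

variable (𝕜 n) in
/-- The map `(M, x) ↦ M* x` as a continuous real bilinear map. -/
def adjL : Mat 𝕜 n →L[ℝ] EuclideanSpace 𝕜 (Fin n) →L[ℝ] EuclideanSpace 𝕜 (Fin (n + 1)) :=
  (LinearMap.mk₂ ℝ (fun M x => M.adj x)
    (fun M N x => by ext j; simp [Mat.adj_apply, add_mul, Finset.sum_add_distrib])
    (fun r M x => by ext j; simp [Mat.adj_apply, Finset.smul_sum, RCLike.real_smul_eq_coe_mul,
      mul_assoc])
    (fun M x y => by ext j; simp [Mat.adj_apply, mul_add, Finset.sum_add_distrib])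
    (fun r M x => by ext j; simp [Mat.adj_apply, Finset.smul_sum])).toContinuousBilinearMap

/-- The equations `M* M v = c v`, `⟪v₀, v⟫ = 1` for a normalized eigenvector and its
eigenvalue. -/
def eigenEq (v₀ : EuclideanSpace 𝕜 (Fin (n + 1)))
    (p : Mat 𝕜 n × (EuclideanSpace 𝕜 (Fin (n + 1)) × 𝕜)) : EuclideanSpace 𝕜 (Fin (n + 1)) × 𝕜 :=
  (p.1.adj (p.1.toLin p.2.1) - p.2.2 • p.2.1, inner 𝕜 v₀ p.2.1 - 1)

theorem contDiff_eval : ContDiff ℝ 2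
    (fun p : Mat 𝕜 n × EuclideanSpace 𝕜 (Fin (n + 1)) => p.1.toLin p.2) :=
  (evalL 𝕜 n).isBoundedBilinearMap.contDiff

theorem contDiff_adj : ContDiff ℝ 2
    (fun p : Mat 𝕜 n × EuclideanSpace 𝕜 (Fin n) => p.1.adj p.2) :=
  (adjL 𝕜 n).isBoundedBilinearMap.contDiff

theorem contDiff_eigenEq (v₀ : EuclideanSpace 𝕜 (Fin (n + 1))) :
    ContDiff ℝ 2 (eigenEq (n := n) v₀) := by
  have h0 : ContDiff ℝ 2 fun p : Mat 𝕜 n × (EuclideanSpace 𝕜 (Fin (n + 1)) × 𝕜) =>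
      (p.1, p.2.1) := contDiff_fst.prodMk contDiff_snd.fst
  have h1 := contDiff_eval.comp h0
  have h2 := contDiff_adj.comp (contDiff_fst.prodMk h1)
  have h3 : ContDiff ℝ 2 fun p : Mat 𝕜 n × (EuclideanSpace 𝕜 (Fin (n + 1)) × 𝕜) =>
      p.2.2 • p.2.1 := contDiff_snd.snd.smul contDiff_snd.fst
  have h4 : ContDiff ℝ 2 fun p : Mat 𝕜 n × (EuclideanSpace 𝕜 (Fin (n + 1)) × 𝕜) =>
      inner 𝕜 v₀ p.2.1 := contDiff_const.inner 𝕜 contDiff_snd.fst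
  exact (h2.sub h3).prodMk (h4.sub contDiff_const)

/-- The implicit function theorem needs only the partial derivative in (v, c), read off here along
the line through (v, c) in direction (w, d). -/
theorem fderiv_eigenEq_apply (v₀ v : EuclideanSpace 𝕜 (Fin (n + 1))) (M : Mat 𝕜 n) (c : 𝕜)
    (w : EuclideanSpace 𝕜 (Fin (n + 1))) (d : 𝕜) :
    fderiv ℝ (eigenEq v₀) (M, (v, c)) (0, (w, d)) =
      (M.adj (M.toLin w) - (c • w + d • v), inner 𝕜 v₀ w) := by
  have hF := ((contDiff_eigenEq (n := n) v₀).differentiable (by norm_num)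
    (M, (v, c))).hasFDerivAt
  have hline : HasDerivAt (fun s : ℝ => ((M, (v + s • w, c + s • d)) :
      Mat 𝕜 n × (EuclideanSpace 𝕜 (Fin (n + 1)) × 𝕜))) (0, (w, d)) 0 := by
    refine (hasDerivAt_const _ _).prodMk (HasDerivAt.prodMk ?_ ?_)
    · simpa using ((hasDerivAt_id (0 : ℝ)).smul_const w).const_add v
    · simpa using ((hasDerivAt_id (0 : ℝ)).smul_const d).const_add c
  have h1 := HasFDerivAt.comp_hasDerivAt (x := (0 : ℝ)) (f := fun s : ℝ =>
    ((M, (v + s • w, c + s • d)) : Mat 𝕜 n × (EuclideanSpace 𝕜 (Fin (n + 1)) × 𝕜)))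
    (l := eigenEq v₀) (by simpa using hF) hline
  refine h1.unique ?_
  have e1 : HasDerivAt (fun s : ℝ => v + s • w) w 0 := by
    simpa using ((hasDerivAt_id (0 : ℝ)).smul_const w).const_add v
  have e2 : HasDerivAt (fun s : ℝ => c + s • d) d 0 := by
    simpa using ((hasDerivAt_id (0 : ℝ)).smul_const d).const_add c
  have e3 : HasDerivAt (fun s : ℝ => adjL 𝕜 n M (evalL 𝕜 n M (v + s • w)))
      (M.adj (M.toLin w)) 0 :=
    (((adjL 𝕜 n M).comp (evalL 𝕜 n M)).hasFDerivAt).comp_hasDerivAt (0 : ℝ) e1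
  have e4 : HasDerivAt (fun s : ℝ => (c + s • d) • (v + s • w)) (c • w + d • v) 0 := by
    exact (e2.smul e1).congr_deriv (by simp)
  have e5 : HasDerivAt (fun s : ℝ => inner 𝕜 v₀ (v + s • w) - 1) (inner 𝕜 v₀ w) 0 := by
    simpa using ((hasDerivAt_const (0 : ℝ) v₀).inner 𝕜 e1).sub_const 1
  exact (e3.sub e4).prodMk e5

/-- Compactness of the unit sphere: each unit w violates an orthogonality relation or satisfies ‖M₀
w‖² ≥ m₀ > m. Lowering m₀ to m makes the second alternative open as well. -/
theorem eventually_bound {M₀ : Mat 𝕜 n} {v₀ ζ₀ : EuclideanSpace 𝕜 (Fin (n + 1))} {l₀ m₀ m : ℝ}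
    (h : IsMinSingular M₀ v₀ ζ₀ l₀ m₀) (hm : m < m₀)
    {V : Mat 𝕜 n → EuclideanSpace 𝕜 (Fin (n + 1))} (hV : ContinuousAt V M₀) (hV0 : V M₀ = v₀) :
    ∀ᶠ p : Mat 𝕜 n × EuclideanSpace 𝕜 (Fin (n + 1)) in 𝓝 (M₀, ζ₀),
      ∀ w, inner 𝕜 (V p.1) w = 0 → inner 𝕜 p.2 w = 0 → m * ‖w‖ ^ 2 ≤ ‖p.1.toLin w‖ ^ 2 := by
  have key : ∀ᶠ p : Mat 𝕜 n × EuclideanSpace 𝕜 (Fin (n + 1)) in 𝓝 (M₀, ζ₀),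
      ∀ w ∈ Metric.sphere (0 : EuclideanSpace 𝕜 (Fin (n + 1))) 1,
        inner 𝕜 (V p.1) w ≠ 0 ∨ inner 𝕜 p.2 w ≠ 0 ∨ m < ‖evalL 𝕜 n p.1 w‖ ^ 2 := by
    refine (isCompact_sphere _ _).eventually_forall_of_forall_eventually fun w hw => ?_
    have c1 : ContinuousAt (fun z : (Mat 𝕜 n × EuclideanSpace 𝕜 (Fin (n + 1))) ×
        EuclideanSpace 𝕜 (Fin (n + 1)) => inner 𝕜 (V z.1.1) z.2) ((M₀, ζ₀), w) := by
      refine ContinuousAt.inner (𝕜 := 𝕜) ?_ continuousAt_snd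
      exact ContinuousAt.comp (f := fun z : (Mat 𝕜 n × EuclideanSpace 𝕜 (Fin (n + 1))) ×
        EuclideanSpace 𝕜 (Fin (n + 1)) => z.1.1) (x := ((M₀, ζ₀), w)) hV (by fun_prop)
    have c2 : ContinuousAt (fun z : (Mat 𝕜 n × EuclideanSpace 𝕜 (Fin (n + 1))) ×
        EuclideanSpace 𝕜 (Fin (n + 1)) => inner 𝕜 z.1.2 z.2) ((M₀, ζ₀), w) := by
      fun_prop
    have c3 : ContinuousAt (fun z : (Mat 𝕜 n × EuclideanSpace 𝕜 (Fin (n + 1))) ×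
        EuclideanSpace 𝕜 (Fin (n + 1)) => ‖evalL 𝕜 n z.1.1 z.2‖ ^ 2) ((M₀, ζ₀), w) := by
      have : Continuous (fun z : (Mat 𝕜 n × EuclideanSpace 𝕜 (Fin (n + 1))) ×
        EuclideanSpace 𝕜 (Fin (n + 1)) => evalL 𝕜 n z.1.1 z.2) :=
        ((evalL 𝕜 n).continuous.comp (continuous_fst.comp continuous_fst)).clm_apply continuous_snd
      exact (this.norm.pow 2).continuousAt
    by_cases h1 : inner 𝕜 v₀ w = 0
    · by_cases h2 : inner 𝕜 ζ₀ w = 0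
      · have h3 := h.bound w h1 h2
        rw [mem_sphere_zero_iff_norm] at hw
        rw [hw, one_pow, mul_one] at h3
        filter_upwards [c3.eventually (lt_mem_nhds (hm.trans_le h3))] with z hz
        exact Or.inr (Or.inr hz)
      · filter_upwards [c2.eventually_ne h2] with z hz
        exact Or.inr (Or.inl hz)
    · have h1' : inner 𝕜 (V M₀) w ≠ 0 := by rwa [hV0]
      filter_upwards [c1.eventually_ne h1'] with z hz
      exact Or.inl hz
  filter_upwards [key] with p hp w hw1 hw2
  by_cases hw : w = 0
  · simp [hw]
  have hw' : ‖w‖ ≠ 0 := norm_ne_zero_iff.2 hw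
  have hsph : ((‖w‖⁻¹ : ℝ) : 𝕜) • w ∈ Metric.sphere (0 : EuclideanSpace 𝕜 (Fin (n + 1))) 1 := by
    rw [mem_sphere_zero_iff_norm, norm_smul, RCLike.norm_ofReal, abs_inv, abs_norm,
      inv_mul_cancel₀ hw']
  rcases hp _ hsph with h1 | h1 | h1
  · exact absurd (by rw [inner_smul_right, hw1, mul_zero]) h1
  · exact absurd (by rw [inner_smul_right, hw2, mul_zero]) h1
  · rw [evalL_apply, map_smul, norm_smul, RCLike.norm_ofReal, abs_inv, abs_norm, mul_pow, inv_pow,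
      inv_mul_eq_div, lt_div_iff₀ (by positivity)] at h1
    exact h1.le

theorem IsMinSingular.exists_contDiffAt {M₀ : Mat 𝕜 n}
    {v₀ ζ₀ : EuclideanSpace 𝕜 (Fin (n + 1))} {l₀ m₀ : ℝ} (h : IsMinSingular M₀ v₀ ζ₀ l₀ m₀) :
    ∃ (V : Mat 𝕜 n → EuclideanSpace 𝕜 (Fin (n + 1))) (Λ : Mat 𝕜 n → ℝ) (l m : ℝ),
      ContDiffAt ℝ 2 V M₀ ∧ ContDiffAt ℝ 2 Λ M₀ ∧ 0 < l ∧ l < m ∧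
      ∀ᶠ p : Mat 𝕜 n × EuclideanSpace 𝕜 (Fin (n + 1)) in 𝓝 (M₀, ζ₀),
        p.1.toLin p.2 = 0 → IsMinSingular p.1 (V p.1) p.2 (Λ p.1) m ∧ Λ p.1 ≤ l := by
  set u : Mat 𝕜 n × (EuclideanSpace 𝕜 (Fin (n + 1)) × 𝕜) := (M₀, (v₀, (l₀ : 𝕜))) with hu
  have cdf : ContDiffAt ℝ 2 (eigenEq v₀) u := (contDiff_eigenEq v₀).contDiffAt
  -- For (w, d) in the kernel, pairing with v₀ gives d = 0. Pairing with w and ζ₀ then gives ‖M₀ w‖²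
  -- = l₀‖w‖² and w ⟂ ζ₀, so the gap m₀ > l₀ forces w = 0.
  have hinj : Function.Injective
      (fderiv ℝ (eigenEq v₀) u ∘L .inr ℝ (Mat 𝕜 n) (EuclideanSpace 𝕜 (Fin (n + 1)) × 𝕜)) := by
    rw [injective_iff_map_eq_zero]
    rintro ⟨w, d⟩ hwd
    have h0 : fderiv ℝ (eigenEq v₀) u (0, (w, d)) = 0 := hwd
    rw [hu, fderiv_eigenEq_apply, Prod.mk_eq_zero, sub_eq_zero] at h0
    obtain ⟨h1, h2⟩ := h0
    have hvv : inner 𝕜 v₀ v₀ = (1 : 𝕜) := by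
      rw [inner_self_eq_norm_sq_to_K, h.norm_eq]; simp
    have hd : d = 0 := by
      have h3 := congrArg (fun x => inner 𝕜 x v₀) h1
      simp only [Mat.inner_adj, inner_add_left, inner_smul_left] at h3
      rw [← inner_conj_symm, h.eig w, map_mul, h2, inner_eq_zero_symm.1 h2, hvv] at h3
      simpa using h3.symm
    have hw : ‖M₀.toLin w‖ ^ 2 = l₀ * ‖w‖ ^ 2 := by
      have h3 := congrArg (fun x => inner 𝕜 x w) h1
      simp only [Mat.inner_adj, hd, zero_smul, add_zero, inner_smul_left,
        RCLike.conj_ofReal, inner_self_eq_norm_sq_to_K] at h3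
      exact_mod_cast h3
    have hζw : inner 𝕜 ζ₀ w = 0 := by
      have h3 := congrArg (fun x => inner 𝕜 x ζ₀) h1
      simp only [Mat.inner_adj, h.ker, hd, zero_smul, add_zero, inner_smul_left,
        RCLike.conj_ofReal, inner_zero_right] at h3
      have := h.pos.ne'
      exact inner_eq_zero_symm.1 (by simpa [this] using h3.symm)
    have h4 := h.bound w h2 hζw
    have h5 : ‖w‖ ^ 2 = 0 := by nlinarith [sq_nonneg ‖w‖, h.lt]
    have h6 : w = 0 := by simpa using h5
    rw [h6, hd, Prod.mk_zero_zero]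
  have hinv : (fderiv ℝ (eigenEq v₀) u ∘L
      .inr ℝ (Mat 𝕜 n) (EuclideanSpace 𝕜 (Fin (n + 1)) × 𝕜)).IsInvertible := by
    refine ⟨(LinearEquiv.ofInjectiveEndo _ hinj).toContinuousLinearEquiv, ?_⟩
    ext x <;> rfl
  set ψ := cdf.implicitFunction (by norm_num) hinv with hψ
  have hψ0 : ψ M₀ = (v₀, (l₀ : 𝕜)) := cdf.implicitFunction_apply_self (by norm_num) hinv
  have hψs : ContDiffAt ℝ 2 ψ M₀ := cdf.contDiffAt_implicitFunction (by norm_num) hinv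
  have hψe : ∀ᶠ M in 𝓝 M₀, eigenEq v₀ (M, ψ M) = eigenEq v₀ u :=
    cdf.eventually_apply_implicitFunction (by norm_num) hinv
  have hs1 : ContDiffAt ℝ 2 (fun M => (ψ M).1) M₀ := hψs.fst
  have hs2 : ContDiffAt ℝ 2 (fun M => (ψ M).2) M₀ := hψs.snd
  have hne : (ψ M₀).1 ≠ 0 := by rw [hψ0]; exact h.v_ne
  set V : Mat 𝕜 n → EuclideanSpace 𝕜 (Fin (n + 1)) := fun M => ‖(ψ M).1‖⁻¹ • (ψ M).1 with hVdef
  set Λ : Mat 𝕜 n → ℝ := fun M => RCLike.re (ψ M).2 with hΛdef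
  have hV : ContDiffAt ℝ 2 V M₀ := ((hs1.norm 𝕜 hne).inv (norm_ne_zero_iff.2 hne)).smul hs1
  have hΛ : ContDiffAt ℝ 2 Λ M₀ := (RCLike.reCLM (K := 𝕜)).contDiff.contDiffAt.comp M₀ hs2
  have hV0 : V M₀ = v₀ := by simp [hVdef, hψ0, h.norm_eq]
  have hΛ0 : Λ M₀ = l₀ := by simp [hΛdef, hψ0]
  obtain ⟨m, hlm', hmm⟩ := exists_between h.lt
  obtain ⟨l, hlm, hl⟩ := exists_between hlm'
  refine ⟨V, Λ, l, m, hV, hΛ, h.pos.trans hlm, hl, ?_⟩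
  have t1 : Filter.Tendsto (fun p : Mat 𝕜 n × EuclideanSpace 𝕜 (Fin (n + 1)) => p.1)
      (𝓝 (M₀, ζ₀)) (𝓝 M₀) := continuous_fst.continuousAt
  have t2 : Filter.Tendsto (fun p : Mat 𝕜 n × EuclideanSpace 𝕜 (Fin (n + 1)) => p.2)
      (𝓝 (M₀, ζ₀)) (𝓝 ζ₀) := continuous_snd.continuousAt
  filter_upwards [eventually_bound h hmm hV.continuousAt hV0, t1.eventually hψe,
    t1.eventually (hΛ.continuousAt.eventually (lt_mem_nhds (hΛ0 ▸ h.pos : 0 < Λ M₀))),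
    t1.eventually (hΛ.continuousAt.eventually (gt_mem_nhds (hΛ0 ▸ hlm : Λ M₀ < l))),
    t1.eventually (hs1.continuousAt.eventually_ne hne), t2.eventually_ne h.ne]
    with p hb he hpos hlt hp0 hζ0 hker
  have hnorm : ‖(ψ p.1).1‖ ≠ 0 := norm_ne_zero_iff.2 hp0
  have heig : p.1.adj (p.1.toLin (ψ p.1).1) = (ψ p.1).2 • (ψ p.1).1 := by
    have h1 := congrArg Prod.fst he
    simp only [eigenEq, hu] at h1
    have h2 : M₀.adj (M₀.toLin v₀) = (l₀ : 𝕜) • v₀ := by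
      refine ext_inner_right 𝕜 fun w => ?_
      rw [Mat.inner_adj, h.eig, inner_smul_left, RCLike.conj_ofReal]
    rwa [h2, sub_self, sub_eq_zero] at h1
  -- The implicit function yields an eigenvalue in 𝕜; it is real because it is a Rayleigh quotient.
  have hreal : (ψ p.1).2 = ((Λ p.1 : ℝ) : 𝕜) := by
    have h1 := congrArg (fun x => inner 𝕜 (ψ p.1).1 x) heig
    simp only [inner_smul_right] at h1
    rw [← inner_conj_symm, Mat.inner_adj, inner_self_eq_norm_sq_to_K,
      inner_self_eq_norm_sq_to_K, ← RCLike.ofReal_pow, ← RCLike.ofReal_pow,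
      RCLike.conj_ofReal] at h1
    have h2 : ((‖(ψ p.1).1‖ ^ 2 : ℝ) : 𝕜) ≠ 0 := by exact_mod_cast pow_ne_zero 2 hnorm
    have h3 : (ψ p.1).2 =
        ((‖p.1.toLin (ψ p.1).1‖ ^ 2 / ‖(ψ p.1).1‖ ^ 2 : ℝ) : 𝕜) := by
      rw [RCLike.ofReal_div, eq_div_iff h2, h1]
    simp only [hΛdef]
    rw [h3, RCLike.ofReal_re]
  refine ⟨⟨hpos, hlt.trans hl, ?_, hζ0, hker, fun w => ?_, hb⟩, hlt.le⟩
  · simp only [hVdef, norm_smul, norm_inv, norm_norm]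
    exact inv_mul_cancel₀ hnorm
  · have e : V p.1 = ((‖(ψ p.1).1‖⁻¹ : ℝ) : 𝕜) • (ψ p.1).1 := by
      simp only [hVdef]
      exact (RCLike.real_smul_eq_coe_smul (K := 𝕜) _ _)
    rw [e, map_smul, inner_smul_left, inner_smul_left, ← Mat.inner_adj, heig, inner_smul_left,
      hreal, RCLike.conj_ofReal, RCLike.conj_ofReal]
    ring

end Smooth

/-! ### Normalized C² lifts and regularity of the condition number -/

section Lifts

variable {𝕜 : Type*} [RCLike 𝕜] {n : ℕ}

theorem Mat.sigma_smul (t : 𝕜) (M : Mat 𝕜 n) (k : ℕ) : (t • M).sigma k = ‖t‖ * M.sigma k := by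
  simp only [Mat.sigma, Mat.toLin_smul, singularValues_smul]

theorem Mat.IsGLSimple.smul {M : Mat 𝕜 n} (h : M.IsGLSimple) {t : 𝕜} (ht : t ≠ 0) :
    (t • M).IsGLSimple := by
  have ht' : 0 < ‖t‖ := norm_pos_iff.2 ht
  simp only [Mat.IsGLSimple, Mat.sigma_smul]
  exact ⟨mul_pos ht' h.1, fun h2 => mul_lt_mul_of_pos_left (h.2 h2) ht'⟩

theorem mk_mem_solutionVariety {M : Mat 𝕜 n} {ζ : EuclideanSpace 𝕜 (Fin (n + 1))} {hM : M ≠ 0}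
    {hζ : ζ ≠ 0} : (Projectivization.mk 𝕜 M hM, Projectivization.mk 𝕜 ζ hζ) ∈ solutionVariety 𝕜 n ↔
      M.IsGLSimple ∧ M.toLin ζ = 0 := by
  refine ⟨?_, fun h => ⟨M, ζ, hM, hζ, rfl, h.1, h.2⟩⟩
  rintro ⟨N, η, hN, hη, h, h1, h2⟩
  rw [Prod.mk.injEq, Projectivization.mk_eq_mk_iff, Projectivization.mk_eq_mk_iff] at h
  obtain ⟨⟨a, ha⟩, b, hb⟩ := h
  rw [Units.smul_def] at ha hb
  subst ha hb
  exact ⟨h1.smul a.ne_zero, by rw [Mat.toLin_smul, map_smul, LinearMap.smul_apply, h2]; simp⟩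

theorem condSq_mk (M : Mat 𝕜 n) (hM : M ≠ 0) (q : ℙ 𝕜 (EuclideanSpace 𝕜 (Fin (n + 1)))) :
    condSq 𝕜 n (Projectivization.mk 𝕜 M hM, q) = ‖M‖ ^ 2 / M.sigma n ^ 2 := rfl

/-- `M` and `ζ` are representatives of the point `p` of the solution variety such that the
smallest singular value of `M` is `1`, with right singular vector `v`. -/
def IsLift (p : ℙ 𝕜 (Mat 𝕜 n) × ℙ 𝕜 (EuclideanSpace 𝕜 (Fin (n + 1)))) (M : Mat 𝕜 n)
    (v ζ : EuclideanSpace 𝕜 (Fin (n + 1))) (m : ℝ) : Prop :=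
  (∃ (hM : M ≠ 0) (hζ : ζ ≠ 0),
    p = (Projectivization.mk 𝕜 M hM, Projectivization.mk 𝕜 ζ hζ)) ∧
  IsMinSingular M v ζ 1 m

theorem IsMinSingular.ne_zero {M : Mat 𝕜 n} {v ζ : EuclideanSpace 𝕜 (Fin (n + 1))} {l m : ℝ}
    (h : IsMinSingular M v ζ l m) : M ≠ 0 := by
  rintro rfl
  have h1 := h.norm_sq
  rw [show (0 : Mat 𝕜 n).toLin v = 0 by ext i; simp [Mat.toLin_apply]] at h1
  have := h.pos
  norm_num at h1
  linarith

theorem IsMinSingular.mk_mem {M : Mat 𝕜 n} {v ζ : EuclideanSpace 𝕜 (Fin (n + 1))} {l m : ℝ}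
    (h : IsMinSingular M v ζ l m) (hn : 1 ≤ n) (hM : M ≠ 0) (hζ : ζ ≠ 0) :
    (Projectivization.mk 𝕜 M hM, Projectivization.mk 𝕜 ζ hζ) ∈ solutionVariety 𝕜 n :=
  mk_mem_solutionVariety.2 ⟨h.isGLSimple hn, h.ker⟩

theorem IsMinSingular.condSq_mk_eq {M : Mat 𝕜 n} {v ζ : EuclideanSpace 𝕜 (Fin (n + 1))} {m : ℝ}
    (h : IsMinSingular M v ζ 1 m) (hn : 1 ≤ n) (hM : M ≠ 0)
    (q : ℙ 𝕜 (EuclideanSpace 𝕜 (Fin (n + 1)))) :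
    condSq 𝕜 n (Projectivization.mk 𝕜 M hM, q) = ‖M‖ ^ 2 := by
  rw [condSq_mk, (h.sigma_sq_eq hn).1, div_one]

theorem IsLift.condSq_eq {p : ℙ 𝕜 (Mat 𝕜 n) × ℙ 𝕜 (EuclideanSpace 𝕜 (Fin (n + 1)))}
    {M : Mat 𝕜 n} {v ζ : EuclideanSpace 𝕜 (Fin (n + 1))} {m : ℝ} (h : IsLift p M v ζ m)
    (hn : 1 ≤ n) :
    condSq 𝕜 n p = ‖M‖ ^ 2 := by
  obtain ⟨⟨hM, hζ, rfl⟩, h⟩ := h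
  exact h.condSq_mk_eq hn hM _

theorem IsMinSingular.normalize {M : Mat 𝕜 n} {v ζ : EuclideanSpace 𝕜 (Fin (n + 1))} {l m : ℝ}
    (h : IsMinSingular M v ζ l m) : IsMinSingular ((Real.sqrt l)⁻¹ • M) v ζ 1 (m / l) := by
  have hl := h.pos
  have hs : 0 < Real.sqrt l := Real.sqrt_pos.2 hl
  have hss : Real.sqrt l ^ 2 = l := Real.sq_sqrt hl.le
  refine ⟨one_pos, (one_lt_div hl).2 h.lt, h.norm_eq, h.ne, ?_, fun w => ?_, fun w h1 h2 => ?_⟩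
  · rw [Mat.toLin_real_smul, h.ker, smul_zero]
  · rw [Mat.toLin_real_smul, Mat.toLin_real_smul, RCLike.real_smul_eq_coe_smul (K := 𝕜),
      RCLike.real_smul_eq_coe_smul (K := 𝕜), inner_smul_left, inner_smul_right, h.eig,
      RCLike.conj_ofReal]
    have : (((Real.sqrt l)⁻¹ : ℝ) : 𝕜) * (((Real.sqrt l)⁻¹ : ℝ) : 𝕜) * (l : 𝕜) = 1 := by
      rw [← RCLike.ofReal_mul, ← RCLike.ofReal_mul]
      rw [show (Real.sqrt l)⁻¹ * (Real.sqrt l)⁻¹ * l = 1 by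
        rw [← mul_inv, ← sq, hss, inv_mul_cancel₀ hl.ne']]
      simp
    rw [← mul_assoc, ← mul_assoc, this, RCLike.ofReal_one]
  · rw [Mat.toLin_real_smul, norm_smul, mul_pow, Real.norm_eq_abs, sq_abs, inv_pow, hss,
      div_mul_eq_mul_div, inv_mul_eq_div]
    exact div_le_div_of_nonneg_right (h.bound w h1 h2) hl.le

theorem IsMinSingular.mono {M : Mat 𝕜 n} {v ζ : EuclideanSpace 𝕜 (Fin (n + 1))} {l m m' : ℝ}
    (h : IsMinSingular M v ζ l m) (h1 : l < m') (h2 : m' ≤ m) : IsMinSingular M v ζ l m' :=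
  ⟨h.pos, h1, h.norm_eq, h.ne, h.ker, h.eig, fun w hv hζ =>
    (mul_le_mul_of_nonneg_right h2 (by positivity)).trans (h.bound w hv hζ)⟩

variable {V : Type*} [NormedAddCommGroup V] [NormedSpace ℝ V]

theorem exists_isLift (hn : 1 ≤ n)
    {f : V → ℙ 𝕜 (Mat 𝕜 n) × ℙ 𝕜 (EuclideanSpace 𝕜 (Fin (n + 1)))} {s : Set V}
    (hf : ContDiffOnProj₂ 2 f s) (hW : ∀ x ∈ s, f x ∈ solutionVariety 𝕜 n) {x : V} (hx : x ∈ s) :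
    ∃ U ∈ 𝓝 x, ∃ (M : V → Mat 𝕜 n) (v ζ : V → EuclideanSpace 𝕜 (Fin (n + 1))) (m : ℝ),
      ContDiffOn ℝ 2 M (s ∩ U) ∧ ContDiffOn ℝ 2 v (s ∩ U) ∧ ContDiffOn ℝ 2 ζ (s ∩ U) ∧
      ∀ y ∈ s ∩ U, IsLift (f y) (M y) (v y) (ζ y) m := by
  obtain ⟨U₁, hU₁, N, hN, hfN⟩ := hf.1 x hx
  obtain ⟨U₂, hU₂, ζ, hζ, hfζ⟩ := hf.2 x hx
  have hmem : ∀ y ∈ s ∩ (U₁ ∩ U₂), ∃ (h1 : N y ≠ 0) (h2 : ζ y ≠ 0),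
      f y = (Projectivization.mk 𝕜 (N y) h1, Projectivization.mk 𝕜 (ζ y) h2) ∧
      Mat.IsGLSimple (N y) ∧ Mat.toLin (N y) (ζ y) = 0 := by
    rintro y ⟨hys, hy1, hy2⟩
    obtain ⟨h1, e1⟩ := hfN y ⟨hys, hy1⟩
    obtain ⟨h2, e2⟩ := hfζ y ⟨hys, hy2⟩
    have e : f y = (Projectivization.mk 𝕜 (N y) h1, Projectivization.mk 𝕜 (ζ y) h2) :=
      Prod.ext e1 e2
    exact ⟨h1, h2, e, mk_mem_solutionVariety.1 (e ▸ hW y hys)⟩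
  have hx' : x ∈ s ∩ (U₁ ∩ U₂) := ⟨hx, mem_of_mem_nhds hU₁, mem_of_mem_nhds hU₂⟩
  obtain ⟨-, hζx, -, hGL, hker⟩ := hmem x hx'
  obtain ⟨v₀, l₀, m₀, h₀⟩ := hGL.exists_isMinSingular hn hζx hker
  obtain ⟨W, Λ, l, m, hW', hΛ, hl, hlm, hev⟩ := h₀.exists_contDiffAt
  have hgood := (hW'.eventually (by simp)).and (hΛ.eventually (by simp))
  have hNc : ContinuousWithinAt N (s ∩ (U₁ ∩ U₂)) x :=
    (hN.continuousOn.mono (Set.inter_subset_inter_right s Set.inter_subset_left)) x hx'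
  have hζc : ContinuousWithinAt ζ (s ∩ (U₁ ∩ U₂)) x :=
    (hζ.continuousOn.mono (Set.inter_subset_inter_right s Set.inter_subset_right)) x hx'
  have ev1 := hNc.eventually hgood
  have ev2 := (hNc.prodMk hζc).eventually hev
  obtain ⟨U₃, hU₃, hU₃'⟩ := mem_nhdsWithin_iff_exists_mem_nhds_inter.1 (ev1.and ev2)
  have hsub : s ∩ (U₁ ∩ U₂ ∩ U₃) ⊆ s ∩ (U₁ ∩ U₂) :=
    Set.inter_subset_inter_right s Set.inter_subset_left
  have hN' : ContDiffOn ℝ 2 N (s ∩ (U₁ ∩ U₂ ∩ U₃)) :=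
    hN.mono (hsub.trans (Set.inter_subset_inter_right s Set.inter_subset_left))
  have hζ' : ContDiffOn ℝ 2 ζ (s ∩ (U₁ ∩ U₂ ∩ U₃)) :=
    hζ.mono (hsub.trans (Set.inter_subset_inter_right s Set.inter_subset_right))
  have hprop : ∀ y ∈ s ∩ (U₁ ∩ U₂ ∩ U₃), (ContDiffAt ℝ 2 W (N y) ∧ ContDiffAt ℝ 2 Λ (N y)) ∧
      IsMinSingular (N y) (W (N y)) (ζ y) (Λ (N y)) m ∧ Λ (N y) ≤ l := by
    intro y hy
    have := hU₃' ⟨hy.2.2, hsub hy⟩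
    obtain ⟨-, -, -, -, hk⟩ := hmem y (hsub hy)
    exact ⟨this.1, this.2 hk⟩
  have hWc : ContDiffOn ℝ 2 (fun y => W (N y)) (s ∩ (U₁ ∩ U₂ ∩ U₃)) := fun y hy =>
    (hprop y hy).1.1.comp_contDiffWithinAt y (hN' y hy)
  have hΛc : ContDiffOn ℝ 2 (fun y => Λ (N y)) (s ∩ (U₁ ∩ U₂ ∩ U₃)) := fun y hy =>
    (hprop y hy).1.2.comp_contDiffWithinAt y (hN' y hy)
  have hpos : ∀ y ∈ s ∩ (U₁ ∩ U₂ ∩ U₃), 0 < Λ (N y) := fun y hy => (hprop y hy).2.1.pos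
  refine ⟨U₁ ∩ U₂ ∩ U₃, Filter.inter_mem (Filter.inter_mem hU₁ hU₂) hU₃,
    fun y => (Real.sqrt (Λ (N y)))⁻¹ • N y, fun y => W (N y), ζ, m / l, ?_, hWc, hζ', fun y hy => ?_⟩
  · exact ((hΛc.sqrt fun y hy => (hpos y hy).ne').inv fun y hy =>
      (Real.sqrt_pos.2 (hpos y hy)).ne').smul hN'
  · obtain ⟨h1, h2, e, -, -⟩ := hmem y (hsub hy)
    obtain ⟨-, hm, hml⟩ := hprop y hy
    -- After normalization the gap is m / Λ, which varies with the point; Λ ≤ l < m makes m / l > 1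
    -- a common lower bound.
    refine ⟨⟨hm.normalize.ne_zero, h2, ?_⟩, hm.normalize.mono ((one_lt_div hl).2 hlm)
      (div_le_div_of_nonneg_left (hl.trans hlm).le hm.pos hml)⟩
    rw [e, Prod.mk.injEq, Projectivization.mk_eq_mk_iff']
    refine ⟨⟨((Real.sqrt (Λ (N y)) : ℝ) : 𝕜), ?_⟩, rfl⟩
    rw [← RCLike.real_smul_eq_coe_smul, smul_smul,
      mul_inv_cancel₀ (Real.sqrt_pos.2 (hpos y hy)).ne', one_smul]

theorem contDiffOn_condSq (hn : 1 ≤ n)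
    {f : V → ℙ 𝕜 (Mat 𝕜 n) × ℙ 𝕜 (EuclideanSpace 𝕜 (Fin (n + 1)))} {s : Set V}
    (hf : ContDiffOnProj₂ 2 f s) (hW : ∀ x ∈ s, f x ∈ solutionVariety 𝕜 n) :
    ContDiffOn ℝ 2 (fun x => condSq 𝕜 n (f x)) s := by
  intro x hx
  obtain ⟨U, hU, M, v, ζ, m, hM, -, -, h⟩ := exists_isLift hn hf hW hx
  have hx' : x ∈ s ∩ U := ⟨hx, mem_of_mem_nhds hU⟩
  have h1 : ContDiffWithinAt ℝ 2 (fun x => condSq 𝕜 n (f x)) (s ∩ U) x :=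
    ((hM.norm_sq 𝕜) x hx').congr (fun y hy => (h y hy).condSq_eq hn) ((h x hx').condSq_eq hn)
  exact h1.mono_of_mem_nhdsWithin
    (Filter.inter_mem self_mem_nhdsWithin (mem_nhdsWithin_of_mem_nhds hU))

theorem condSq_pos {p : ℙ 𝕜 (Mat 𝕜 n) × ℙ 𝕜 (EuclideanSpace 𝕜 (Fin (n + 1)))}
    (hp : p ∈ solutionVariety 𝕜 n) : 0 < condSq 𝕜 n p := by
  obtain ⟨M, ζ, hM, hζ, rfl, h, -⟩ := hp
  rw [condSq_mk]
  have := h.1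
  have := norm_pos_iff.2 hM
  positivity

end Lifts

/-! ### The second variation inequality and the energy density -/

section Convexity

variable {𝕜 : Type*} [RCLike 𝕜] {n : ℕ}

theorem toLin_sub_outer (M : Mat 𝕜 n) (v w : EuclideanSpace 𝕜 (Fin (n + 1))) :
    (M - outer (M.toLin v) v).toLin w = M.toLin w - inner 𝕜 v w • M.toLin v := by
  rw [Mat.toLin_sub, LinearMap.sub_apply, toLin_outer]

section

variable {M : Mat 𝕜 n} {v ζ : EuclideanSpace 𝕜 (Fin (n + 1))} {m : ℝ}

theorem IsMinSingular.inner_self_v (h : IsMinSingular M v ζ 1 m) : inner 𝕜 v v = (1 : 𝕜) := by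
  rw [inner_self_eq_norm_sq_to_K, h.norm_eq]; simp

theorem IsMinSingular.residual_v (h : IsMinSingular M v ζ 1 m) :
    (M - outer (M.toLin v) v).toLin v = 0 := by
  rw [toLin_sub_outer, h.inner_self_v, one_smul, sub_self]

theorem IsMinSingular.residual_ker (h : IsMinSingular M v ζ 1 m) :
    (M - outer (M.toLin v) v).toLin ζ = 0 := by
  rw [toLin_sub_outer, h.inner_eq_zero, h.ker, zero_smul, sub_zero]

/-- By ⟨M v, M w⟩ = ⟨v, w⟩, subtracting ⟨v, w⟩ M v removes exactly the component of M w along the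
unit vector M v. -/
theorem IsMinSingular.inner_residual (h : IsMinSingular M v ζ 1 m) (w) :
    inner 𝕜 (M.toLin v) ((M - outer (M.toLin v) v).toLin w) = 0 := by
  rw [toLin_sub_outer, inner_sub_right, inner_smul_right, h.eig, h.eig, h.inner_self_v]
  simp

/-- The second variation estimate: `B' = D + κ B` is the derivative of `B = M - u v*`, where
`u = M v`, and `u' v* + u v'*` is the derivative of `u v*`. -/
theorem IsMinSingular.second_variation_nonneg (h : IsMinSingular M v ζ 1 m)
    {B' : Mat 𝕜 n} {u' : EuclideanSpace 𝕜 (Fin n)} {v' : EuclideanSpace 𝕜 (Fin (n + 1))}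
    (h1 : B'.toLin v + (M - outer (M.toLin v) v).toLin v' = 0)
    (h2 : ∀ w, inner 𝕜 u' ((M - outer (M.toLin v) v).toLin w) +
      inner 𝕜 (M.toLin v) (B'.toLin w) = 0) (κ : 𝕜) :
    0 ≤ ‖B' - κ • (M - outer (M.toLin v) v)‖ ^ 2 + RCLike.re
      (inner 𝕜 (outer u' v + outer (M.toLin v) v') (B' - κ • (M - outer (M.toLin v) v))) := by
  set u := M.toLin v with hu
  set B := M - outer u v with hB
  set D := B' - κ • B with hD
  have hBv : B.toLin v = 0 := h.residual_v
  have hBζ : B.toLin ζ = 0 := h.residual_ker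
  have huB : ∀ w, inner 𝕜 u (B.toLin w) = 0 := h.inner_residual
  have hDw : ∀ w, D.toLin w = B'.toLin w - κ • B.toLin w := fun w => by
    rw [hD, Mat.toLin_sub, Mat.toLin_smul]; rfl
  -- Replacing B' by D is harmless here and in `huD`, because B v = 0 and u*B = 0.
  have hDv : D.toLin v = -B.toLin v' := by
    rw [hDw, hBv, smul_zero, sub_zero, eq_neg_iff_add_eq_zero, h1]
  have huD : ∀ w, inner 𝕜 u (D.toLin w) = -inner 𝕜 u' (B.toLin w) := fun w => by
    rw [hDw, inner_sub_right, inner_smul_right, huB, mul_zero, sub_zero, eq_neg_iff_add_eq_zero,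
      add_comm, h2]
  have hA : inner 𝕜 (outer u' v + outer u v') D = -(2 * inner 𝕜 u' (B.toLin v')) := by
    rw [inner_add_left, inner_outer, inner_outer, hDv, huD, inner_neg_right]
    ring
  set g := B.adj u' with hg
  have hgw : ∀ w, inner 𝕜 g w = inner 𝕜 u' (B.toLin w) := fun w => B.inner_adj u' w
  have hu1 : ‖u‖ ^ 2 = 1 := h.norm_sq
  have hBu : inner 𝕜 (B.toLin v') u = 0 := inner_eq_zero_symm.1 (huB v')
  -- -R is the part D v v* + u u* D of D. Its two terms are orthogonal since u ⟂ B v', and ⟨R, D⟩ =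
  -- -‖R‖², so ‖R + D‖² ≥ 0 yields ‖R‖² ≤ ‖D‖².
  set R := outer (B.toLin v') v + outer u g with hR
  have hRn : ‖R‖ ^ 2 = ‖B.toLin v'‖ ^ 2 + ‖g‖ ^ 2 := by
    rw [hR, @norm_add_sq 𝕜, norm_outer_sq, norm_outer_sq, hu1, h.norm_eq, inner_outer, toLin_outer,
      inner_smul_right, hBu]
    simp
  have hRD : inner 𝕜 R D = -((‖B.toLin v'‖ ^ 2 + ‖g‖ ^ 2 : ℝ) : 𝕜) := by
    rw [hR, inner_add_left, inner_outer, inner_outer, hDv, huD, ← hgw, inner_neg_right,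
      inner_self_eq_norm_sq_to_K, inner_self_eq_norm_sq_to_K]
    push_cast
    ring
  have hDn : ‖B.toLin v'‖ ^ 2 + ‖g‖ ^ 2 ≤ ‖D‖ ^ 2 := by
    have e := @norm_add_sq 𝕜 _ _ _ _ R D
    rw [hRD, hRn, map_neg, RCLike.ofReal_re] at e
    nlinarith [sq_nonneg ‖R + D‖]
  -- B kills v and ζ, so B y = B v'. On y the maps B and M agree, and `bound` with m > 1 gives ‖y‖ ≤
  -- ‖B v'‖: this is where minimality of σ_n enters.
  set y := v' - inner 𝕜 v v' • v - (inner 𝕜 ζ v' / inner 𝕜 ζ ζ) • ζ with hy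
  have hζζ : inner 𝕜 ζ ζ ≠ 0 := by simpa using h.ne
  have hvζ := h.inner_eq_zero
  have hζv : inner 𝕜 ζ v = 0 := inner_eq_zero_symm.1 hvζ
  have hvy : inner 𝕜 v y = 0 := by
    rw [hy, inner_sub_right, inner_sub_right, inner_smul_right, inner_smul_right, hvζ,
      h.inner_self_v]
    ring
  have hζy : inner 𝕜 ζ y = 0 := by
    rw [hy, inner_sub_right, inner_sub_right, inner_smul_right, inner_smul_right, hζv,
      div_mul_cancel₀ _ hζζ]
    ring
  have hBy : B.toLin y = B.toLin v' := by
    rw [hy, map_sub, map_sub, map_smul, map_smul, hBv, hBζ, smul_zero, smul_zero, sub_zero,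
      sub_zero]
  have hMy : B.toLin y = M.toLin y := by
    rw [hB, hu, toLin_sub_outer, hvy, zero_smul, sub_zero]
  have hyn : ‖y‖ ≤ ‖B.toLin v'‖ := by
    have h3 := h.bound y hvy hζy
    rw [← hMy, hBy] at h3
    have h4 : ‖y‖ ^ 2 ≤ ‖B.toLin v'‖ ^ 2 := by nlinarith [sq_nonneg ‖y‖, h.lt]
    exact (sq_le_sq₀ (norm_nonneg _) (norm_nonneg _)).1 h4
  have hre : RCLike.re (inner 𝕜 u' (B.toLin v')) ≤ ‖g‖ * ‖B.toLin v'‖ := by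
    rw [← hBy, ← hgw]
    exact ((RCLike.re_le_norm _).trans (norm_inner_le_norm _ _)).trans
      (mul_le_mul_of_nonneg_left (hBy ▸ hyn) (norm_nonneg _))
  have h2re : RCLike.re (inner 𝕜 (outer u' v + outer u v') D)
      = -(2 * RCLike.re (inner 𝕜 u' (B.toLin v'))) := by
    rw [hA, map_neg, ← RCLike.re_ofReal_mul]
    simp
  rw [h2re]
  nlinarith [sq_nonneg (‖B.toLin v'‖ - ‖g‖)]

/-- Scaling the singular values other than the smallest one. -/
theorem IsMinSingular.scale (h : IsMinSingular M v ζ 1 m) {c : ℝ} (hc : 1 < c ^ 2 * m) :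
    IsMinSingular (outer (M.toLin v) v + c • (M - outer (M.toLin v) v)) v ζ 1 (c ^ 2 * m) := by
  have key : ∀ w, (outer (M.toLin v) v + c • (M - outer (M.toLin v) v)).toLin w =
      inner 𝕜 v w • M.toLin v + c • (M - outer (M.toLin v) v).toLin w := fun w => by
    rw [Mat.toLin_add, LinearMap.add_apply, toLin_outer, Mat.toLin_real_smul]
  refine ⟨one_pos, hc, h.norm_eq, h.ne, ?_, fun w => ?_, fun w h1 h2 => ?_⟩
  · rw [key, h.inner_eq_zero, h.residual_ker, zero_smul, smul_zero, add_zero]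
  · rw [key, key, h.residual_v, h.inner_self_v, one_smul, smul_zero, add_zero, inner_add_right,
      RCLike.real_smul_eq_coe_smul (K := 𝕜), inner_smul_right, inner_smul_right, h.inner_residual,
      h.eig, h.inner_self_v]
    simp
  · rw [key, h1, zero_smul, zero_add, toLin_sub_outer, h1, zero_smul, sub_zero, norm_smul, mul_pow,
      Real.norm_eq_abs, sq_abs, mul_assoc]
    exact mul_le_mul_of_nonneg_left (h.bound w h1 h2) (by positivity)

end

theorem fubiniStudySq_nonneg {ι : Type*} [Fintype ι] (v w : EuclideanSpace 𝕜 ι) :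
    0 ≤ fubiniStudySq v w := by
  have h := pow_le_pow_left₀ (norm_nonneg _) (norm_inner_le_norm (𝕜 := 𝕜) v w) 2
  rw [mul_pow] at h
  exact div_nonneg (sub_nonneg.2 h) (by positivity)

/-- The energy density of the variation `A + exp(-s φ) B` in terms of `φ`, `ψ = φ'` and the
inner products of `A`, `B` and their derivatives. -/
def density (s : ℝ) (k : Fin 11 → ℝ) : ℝ :=
  k 2 + 2 * Real.exp (-(s * k 0)) * k 3 + Real.exp (-(s * k 0)) ^ 2 *
    (k 4 - 2 * (s * k 1) * k 5 + (s * k 1) ^ 2 * k 6 ^ 2) -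
  (k 7 + 2 * Real.exp (-(s * k 0)) ^ 2 * k 8 + Real.exp (-(s * k 0)) ^ 4 * k 9
    - 2 * Real.exp (-(s * k 0)) ^ 4 * (s * k 1) * k 6 ^ 2 * k 5
    + Real.exp (-(s * k 0)) ^ 4 * (s * k 1) ^ 2 * k 6 ^ 4) / (1 + Real.exp (-(s * k 0)) ^ 2 * k 6 ^ 2)
  + (1 + Real.exp (-(s * k 0)) ^ 2 * k 6 ^ 2) * k 10

theorem contDiff_density : ContDiff ℝ 1 fun p : ℝ × (Fin 11 → ℝ) => density p.1 p.2 := by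
  have hk : ∀ i, ContDiff ℝ 1 fun p : ℝ × (Fin 11 → ℝ) => p.2 i := fun i =>
    (contDiff_apply ℝ ℝ i).comp contDiff_snd
  have hc : ContDiff ℝ 1 fun p : ℝ × (Fin 11 → ℝ) => Real.exp (-(p.1 * p.2 0)) :=
    (contDiff_fst.mul (hk 0)).neg.exp
  unfold density
  have hd : ContDiff ℝ 1 fun p : ℝ × (Fin 11 → ℝ) =>
    1 + Real.exp (-(p.1 * p.2 0)) ^ 2 * p.2 6 ^ 2 := contDiff_const.add ((hc.pow 2).mul ((hk 6).pow 2))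
  have he : ContDiff ℝ 1 fun p : ℝ × (Fin 11 → ℝ) => p.1 * p.2 1 := contDiff_fst.mul (hk 1)
  have h2 : ContDiff ℝ 1 fun _ : ℝ × (Fin 11 → ℝ) => (2 : ℝ) := contDiff_const
  refine ((((hk 2).add ((h2.mul hc).mul (hk 3))).add ((hc.pow 2).mul (((hk 4).sub
    ((h2.mul he).mul (hk 5))).add ((he.pow 2).mul ((hk 6).pow 2))))).sub (ContDiff.div
    (((((hk 7).add ((h2.mul (hc.pow 2)).mul (hk 8))).add ((hc.pow 4).mul (hk 9))).sub
      ((((h2.mul (hc.pow 4)).mul he).mul ((hk 6).pow 2)).mul (hk 5))).add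
      (((hc.pow 4).mul (he.pow 2)).mul ((hk 6).pow 4))) hd fun p => ?_)).add (hd.mul (hk 10))
  positivity

/-- With k from `params`, the factor after `2 * k 0` is Q, and the last term is φ'(log α₂)'. -/
theorem hasDerivAt_density (k : Fin 11 → ℝ) :
    HasDerivAt (fun s => density s k)
      (-(2 * k 0 * (k 3 + k 4 - 2 * (k 8 + k 9) / (1 + k 6 ^ 2) +
        k 6 ^ 2 * (k 7 + 2 * k 8 + k 9) / (1 + k 6 ^ 2) ^ 2 + k 6 ^ 2 * k 10)) -
        k 1 * (2 * k 5 / (1 + k 6 ^ 2))) 0 := by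
  have hc : HasDerivAt (fun s : ℝ => Real.exp (-(s * k 0))) (-k 0) 0 := by
    simpa using (((hasDerivAt_id (0 : ℝ)).mul_const (k 0)).neg).exp
  have he : HasDerivAt (fun s : ℝ => s * k 1) (k 1) 0 := by
    simpa using (hasDerivAt_id (0 : ℝ)).mul_const (k 1)
  have hd := ((hc.pow 2).mul_const (k 6 ^ 2)).const_add 1
  have hpos : 1 + k 6 ^ 2 ≠ 0 := by positivity
  have hnum := ((((((hc.pow 2).const_mul 2).mul_const (k 8)).const_add (k 7)).add
    ((hc.pow 4).mul_const (k 9))).sub (((((hc.pow 4).const_mul 2).mul he).mul_const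
    (k 6 ^ 2)).mul_const (k 5))).add (((hc.pow 4).mul (he.pow 2)).mul_const (k 6 ^ 4))
  have hmain := (((((hc.const_mul 2).mul_const (k 3)).const_add (k 2)).add ((hc.pow 2).mul
    ((((he.const_mul 2).mul_const (k 5)).const_sub (k 4)).add
      ((he.pow 2).mul_const (k 6 ^ 2))))).sub
    (hnum.div hd (by simpa using hpos))).add (hd.mul_const (k 10))
  refine hmain.congr_deriv ?_
  simp
  field_simp
  ring

/-- Since t enters only through the continuous k, the s-derivative is bounded on the compact set
[-1, 1] × [a, b], and domination by a constant suffices. -/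
theorem hasDerivAt_integral_of_contDiff {X : Type*} [NormedAddCommGroup X] [NormedSpace ℝ X]
    {G : ℝ × X → ℝ} (hG : ContDiff ℝ 1 G) {k : ℝ → X} {a b : ℝ} (hab : a ≤ b)
    (hk : ContinuousOn k (Set.Icc a b)) {g : ℝ → ℝ}
    (hg : ∀ t, HasDerivAt (fun s => G (s, k t)) (g t) 0) :
    IntervalIntegrable g MeasureTheory.volume a b ∧
      HasDerivAt (fun s => ∫ t in a..b, G (s, k t)) (∫ t in a..b, g t) 0 := by
  have hd : ∀ s t, HasDerivAt (fun s => G (s, k t)) (fderiv ℝ G (s, k t) (1, 0)) s := fun s t => by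
    have h1 : HasFDerivAt G (fderiv ℝ G (s, k t)) (s, k t) :=
      (hG.differentiable (by norm_num) (s, k t)).hasFDerivAt
    have h2 : HasDerivAt (fun s : ℝ => (s, k t)) ((1 : ℝ), (0 : X)) s :=
      (hasDerivAt_id s).prodMk (hasDerivAt_const s (k t))
    exact h1.comp_hasDerivAt s h2
  obtain rfl : g = fun t => fderiv ℝ G (0, k t) (1, 0) := funext fun t => (hg t).unique (hd 0 t)
  have hF : Continuous fun p : ℝ × X => fderiv ℝ G p (1, 0) :=
    (hG.continuous_fderiv (by norm_num)).clm_apply continuous_const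
  have hkc : ∀ s : ℝ, ContinuousOn (fun t => (s, k t)) (Set.Icc a b) := fun s =>
    continuousOn_const.prodMk hk
  have hprod : ContinuousOn (fun p : ℝ × ℝ => fderiv ℝ G (p.1, k p.2) (1, 0))
      (Set.Icc (-1) 1 ×ˢ Set.Icc a b) :=
    hF.comp_continuousOn (continuousOn_fst.prodMk (hk.comp continuousOn_snd fun p hp => hp.2))
  obtain ⟨C, hC⟩ := (isCompact_Icc.prod isCompact_Icc).exists_bound_of_continuousOn hprod
  have hI : Set.uIoc a b ⊆ Set.Icc a b := by
    rw [Set.uIoc_of_le hab]; exact Set.Ioc_subset_Icc_self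
  refine intervalIntegral.hasDerivAt_integral_of_dominated_loc_of_deriv_le
    (F' := fun s t => fderiv ℝ G (s, k t) (1, 0)) (bound := fun _ => C)
    (Icc_mem_nhds (by norm_num : (-1 : ℝ) < 0) one_pos) ?_ ?_ ?_ ?_ ?_ ?_
  · exact Filter.Eventually.of_forall fun s =>
      ((hG.continuous.comp_continuousOn (hkc s)).mono hI).aestronglyMeasurable measurableSet_uIoc
  · exact (hG.continuous.comp_continuousOn (by rw [Set.uIcc_of_le hab]; exact hkc 0)
      ).intervalIntegrable
  · exact ((hF.comp_continuousOn (hkc 0)).mono hI).aestronglyMeasurable measurableSet_uIoc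
  · exact Filter.Eventually.of_forall fun t ht s hs => hC (s, t) ⟨hs, hI ht⟩
  · exact intervalIntegrable_const
  · exact Filter.Eventually.of_forall fun t _ s _ => hd s t

/-- The energy density of `A + c B` in terms of inner products. -/
theorem norm_sq_mul_fubiniStudySq {A B A' B' : Mat 𝕜 n} (hA : ‖A‖ = 1) (hAB : inner 𝕜 A B = 0)
    (hAB' : inner 𝕜 A B' = 0) (hA'B : inner 𝕜 A' B = 0) (hAA' : RCLike.re (inner 𝕜 A A') = 0)
    (c e : ℝ) :
    ‖A + c • B‖ ^ 2 = 1 + c ^ 2 * ‖B‖ ^ 2 ∧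
    ‖A + c • B‖ ^ 2 * fubiniStudySq (A + c • B) (A' + c • (B' - e • B)) =
      ‖A'‖ ^ 2 + 2 * c * RCLike.re (inner 𝕜 A' B') + c ^ 2 *
        (‖B'‖ ^ 2 - 2 * e * RCLike.re (inner 𝕜 B B') + e ^ 2 * ‖B‖ ^ 2) -
      (‖inner 𝕜 A A'‖ ^ 2 + 2 * c ^ 2 * RCLike.re (starRingEnd 𝕜 (inner 𝕜 A A') * inner 𝕜 B B')
        + c ^ 4 * ‖inner 𝕜 B B'‖ ^ 2 - 2 * c ^ 4 * e * ‖B‖ ^ 2 * RCLike.re (inner 𝕜 B B')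
        + c ^ 4 * e ^ 2 * ‖B‖ ^ 4) / (1 + c ^ 2 * ‖B‖ ^ 2) := by
  have hBA : inner 𝕜 B A = 0 := inner_eq_zero_symm.1 hAB
  have hBA' : inner 𝕜 B A' = 0 := inner_eq_zero_symm.1 hA'B
  have h1 : ‖A + c • B‖ ^ 2 = 1 + c ^ 2 * ‖B‖ ^ 2 := by
    rw [RCLike.real_smul_eq_coe_smul (K := 𝕜), @norm_add_sq 𝕜, inner_smul_right, hAB, norm_smul, hA,
      RCLike.norm_ofReal, mul_pow, sq_abs]
    simp
  have h2 : ‖A' + c • (B' - e • B)‖ ^ 2 = ‖A'‖ ^ 2 + 2 * c * RCLike.re (inner 𝕜 A' B') + c ^ 2 *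
        (‖B'‖ ^ 2 - 2 * e * RCLike.re (inner 𝕜 B B') + e ^ 2 * ‖B‖ ^ 2) := by
    rw [RCLike.real_smul_eq_coe_smul (K := 𝕜), RCLike.real_smul_eq_coe_smul (K := 𝕜) e,
      @norm_add_sq 𝕜, inner_smul_right, inner_sub_right, inner_smul_right, hA'B, norm_smul,
      RCLike.norm_ofReal, mul_pow, sq_abs, @norm_sub_sq 𝕜, inner_smul_right, norm_smul,
      RCLike.norm_ofReal, mul_pow, sq_abs, mul_zero, sub_zero, RCLike.re_ofReal_mul,
      RCLike.re_ofReal_mul, ← inner_conj_symm B' B, RCLike.conj_re]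
    ring
  have h3 : inner 𝕜 (A + c • B) (A' + c • (B' - e • B)) =
      inner 𝕜 A A' + ((c ^ 2 : ℝ) : 𝕜) * inner 𝕜 B B' - ((c ^ 2 * e * ‖B‖ ^ 2 : ℝ) : 𝕜) := by
    rw [RCLike.real_smul_eq_coe_smul (K := 𝕜), RCLike.real_smul_eq_coe_smul (K := 𝕜) c,
      RCLike.real_smul_eq_coe_smul (K := 𝕜) e, inner_add_left, inner_add_right, inner_add_right,
      inner_smul_right, inner_smul_left, inner_smul_left, inner_smul_right, inner_sub_right,
      inner_sub_right, inner_smul_right, inner_smul_right, hAB, hAB', hBA',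
      inner_self_eq_norm_sq_to_K, RCLike.conj_ofReal]
    push_cast
    ring
  -- ⟨A, A'⟩ is purely imaginary, so it has no cross term with the real number c²e‖B‖².
  have h4 : ‖inner 𝕜 (A + c • B) (A' + c • (B' - e • B))‖ ^ 2 =
      ‖inner 𝕜 A A'‖ ^ 2 + 2 * c ^ 2 * RCLike.re (starRingEnd 𝕜 (inner 𝕜 A A') * inner 𝕜 B B')
        + c ^ 4 * ‖inner 𝕜 B B'‖ ^ 2 - 2 * c ^ 4 * e * ‖B‖ ^ 2 * RCLike.re (inner 𝕜 B B')
        + c ^ 4 * e ^ 2 * ‖B‖ ^ 4 := by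
    rw [h3]
    simp only [RCLike.norm_sq_eq_def, RCLike.mul_re, map_add, map_sub, RCLike.conj_re,
      RCLike.conj_im, RCLike.ofReal_re, RCLike.ofReal_im, RCLike.im_ofReal_mul, hAA']
    ring
  refine ⟨h1, ?_⟩
  have hpos : 1 + c ^ 2 * ‖B‖ ^ 2 ≠ 0 := by positivity
  rw [fubiniStudySq, h4, h2, show ‖A + c • B‖ ^ 4 = (‖A + c • B‖ ^ 2) ^ 2 by ring, h1]
  field_simp

end Convexity

/-! ### Variation of a geodesic and convexity of log α₂ -/

section Geodesics

variable {𝕜 : Type*} [RCLike 𝕜] {n : ℕ}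

/-- The weight is φ'. If d < 0, then g - g(t₀) has the sign of t₀ - t near t₀, so its weighted
integral is positive, while the constant g(t₀) contributes 0 by symmetry. No integration by parts,
hence no continuity of g', is required. -/
theorem nonneg_of_integral_nonpos {g : ℝ → ℝ} {t₀ d : ℝ} {J : Set ℝ} (hJ : J ∈ 𝓝 t₀)
    (hg : HasDerivAt g d t₀) (hc : ContinuousOn g J)
    (hint : ∀ h > 0, Set.Icc (t₀ - h) (t₀ + h) ⊆ J →
      ∫ t in (t₀ - h)..(t₀ + h), ((t₀ - h) + (t₀ + h) - 2 * t) * g t ≤ 0) : 0 ≤ d := by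
  by_contra! hd
  have h1 := (hasDerivAt_iff_tendsto_slope.1 hg).eventually (gt_mem_nhds hd)
  rw [eventually_nhdsWithin_iff] at h1
  obtain ⟨ε, hε, hball⟩ := Metric.mem_nhds_iff.1 (Filter.inter_mem h1 hJ)
  have hsub : Set.Icc (t₀ - ε / 2) (t₀ + ε / 2) ⊆ Metric.ball t₀ ε := by
    intro t ht
    rw [Metric.mem_ball, Real.dist_eq, abs_lt]
    constructor <;> linarith [ht.1, ht.2]
  have hsubJ : Set.Icc (t₀ - ε / 2) (t₀ + ε / 2) ⊆ J := fun t ht => (hball (hsub ht)).2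
  have hle : t₀ - ε / 2 < t₀ + ε / 2 := by linarith
  have key := hint (ε / 2) (half_pos hε) hsubJ
  have hpt : ∀ t ∈ Set.Icc (t₀ - ε / 2) (t₀ + ε / 2), t ≠ t₀ →
      0 < (2 * t₀ - 2 * t) * (g t - g t₀) := by
    intro t ht hne
    have h2 : slope g t₀ t < 0 := (hball (hsub ht)).1 hne
    have h3 : t - t₀ ≠ 0 := sub_ne_zero.2 hne
    have h4 : g t - g t₀ = slope g t₀ t * (t - t₀) := by
      rw [slope_def_field, div_mul_cancel₀ _ h3]
    rw [h4]
    have : 0 < (t - t₀) ^ 2 := by positivity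
    nlinarith
  have hcont : ContinuousOn (fun t => (2 * t₀ - 2 * t) * (g t - g t₀))
      (Set.Icc (t₀ - ε / 2) (t₀ + ε / 2)) :=
    (by fun_prop : Continuous fun t : ℝ => 2 * t₀ - 2 * t).continuousOn.mul
      ((hc.mono hsubJ).sub continuousOn_const)
  have hpos : 0 < ∫ t in (t₀ - ε / 2)..(t₀ + ε / 2), (2 * t₀ - 2 * t) * (g t - g t₀) := by
    refine intervalIntegral.integral_pos hle hcont (fun t ht => ?_)
      ⟨t₀ + ε / 2, Set.right_mem_Icc.2 hle.le, hpt _ (Set.right_mem_Icc.2 hle.le) (by linarith)⟩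
    by_cases hne : t = t₀
    · simp [hne]
    · exact (hpt t (Set.Ioc_subset_Icc_self ht) hne).le
  have hz : ∫ t in (t₀ - ε / 2)..(t₀ + ε / 2), (2 * t₀ - 2 * t) * g t₀ = 0 := by
    rw [intervalIntegral.integral_mul_const, intervalIntegral.integral_sub (by simp)
      ((by fun_prop : Continuous fun t : ℝ => 2 * t).intervalIntegrable _ _),
      intervalIntegral.integral_const, intervalIntegral.integral_const_mul, integral_id,
      smul_eq_mul]
    ring
  have hsum : ∫ t in (t₀ - ε / 2)..(t₀ + ε / 2), ((t₀ - ε / 2) + (t₀ + ε / 2) - 2 * t) * g t =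
      (∫ t in (t₀ - ε / 2)..(t₀ + ε / 2), (2 * t₀ - 2 * t) * (g t - g t₀)) +
      ∫ t in (t₀ - ε / 2)..(t₀ + ε / 2), (2 * t₀ - 2 * t) * g t₀ := by
    rw [← intervalIntegral.integral_add (hcont.intervalIntegrable_of_Icc hle.le)
      ((by fun_prop : Continuous fun t : ℝ => (2 * t₀ - 2 * t) * g t₀).intervalIntegrable _ _)]
    exact intervalIntegral.integral_congr fun t _ => by ring
  linarith

/-- A `C²` curve of lifts of points of the solution variety. -/
structure IsLiftCurve (γ : ℝ → ℙ 𝕜 (Mat 𝕜 n) × ℙ 𝕜 (EuclideanSpace 𝕜 (Fin (n + 1))))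
    (M : ℝ → Mat 𝕜 n) (v ζ : ℝ → EuclideanSpace 𝕜 (Fin (n + 1))) (m : ℝ) (J : Set ℝ) : Prop where
  isOpen : IsOpen J
  contDiff_M : ContDiffOn ℝ 2 M J
  contDiff_v : ContDiffOn ℝ 2 v J
  contDiff_ζ : ContDiffOn ℝ 2 ζ J
  lift : ∀ t ∈ J, IsLift (γ t) (M t) (v t) (ζ t) m

/-- The part `σ_n u v*` of the curve of matrices. -/
def minPart (M : ℝ → Mat 𝕜 n) (v : ℝ → EuclideanSpace 𝕜 (Fin (n + 1))) (t : ℝ) : Mat 𝕜 n :=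
  outer ((M t).toLin (v t)) (v t)

/-- The part of the curve of matrices that belongs to the other singular values. -/
def restPart (M : ℝ → Mat 𝕜 n) (v : ℝ → EuclideanSpace 𝕜 (Fin (n + 1))) (t : ℝ) : Mat 𝕜 n :=
  M t - outer ((M t).toLin (v t)) (v t)

namespace IsLiftCurve

variable {γ : ℝ → ℙ 𝕜 (Mat 𝕜 n) × ℙ 𝕜 (EuclideanSpace 𝕜 (Fin (n + 1)))}
  {M : ℝ → Mat 𝕜 n} {v ζ : ℝ → EuclideanSpace 𝕜 (Fin (n + 1))} {m : ℝ} {J : Set ℝ}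

theorem isMin (h : IsLiftCurve γ M v ζ m J) {t : ℝ} (ht : t ∈ J) :
    IsMinSingular (M t) (v t) (ζ t) 1 m := (h.lift t ht).2

theorem _root_.ContDiffOn.hasDerivAt_of_isOpen {X : Type*} [NormedAddCommGroup X]
    [NormedSpace ℝ X] {f : ℝ → X} {J : Set ℝ} (hf : ContDiffOn ℝ 2 f J) (hJ : IsOpen J) {t : ℝ}
    (ht : t ∈ J) : HasDerivAt f (deriv f t) t :=
  ((hf.contDiffAt (hJ.mem_nhds ht)).differentiableAt (by norm_num)).hasDerivAt

theorem contDiff_min (h : IsLiftCurve γ M v ζ m J) : ContDiffOn ℝ 2 (minPart M v) J :=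
  (h.contDiff_M.toLin h.contDiff_v).outer h.contDiff_v

theorem contDiff_rest (h : IsLiftCurve γ M v ζ m J) : ContDiffOn ℝ 2 (restPart M v) J :=
  h.contDiff_M.sub h.contDiff_min

theorem deriv_min (h : IsLiftCurve γ M v ζ m J) {t : ℝ} (ht : t ∈ J) :
    deriv (minPart M v) t = outer (deriv (fun s => (M s).toLin (v s)) t) (v t)
      + outer ((M t).toLin (v t)) (deriv v t) :=
  (hasDerivAt_outer ((h.contDiff_M.toLin h.contDiff_v).hasDerivAt_of_isOpen h.isOpen ht)
    (h.contDiff_v.hasDerivAt_of_isOpen h.isOpen ht)).deriv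

/-- The derivative of B v = 0. With that of u*B = 0 in `inner_deriv_rest`, it supplies the
hypotheses of the second variation estimate. -/
theorem deriv_rest_v (h : IsLiftCurve γ M v ζ m J) {t : ℝ} (ht : t ∈ J) :
    (deriv (restPart M v) t).toLin (v t) + (restPart M v t).toLin (deriv v t) = 0 := by
  have h1 := hasDerivAt_toLin (h.contDiff_rest.hasDerivAt_of_isOpen h.isOpen ht)
    (h.contDiff_v.hasDerivAt_of_isOpen h.isOpen ht)
  have h2 : (fun s => (restPart M v s).toLin (v s)) =ᶠ[𝓝 t] fun _ => 0 := by
    filter_upwards [h.isOpen.mem_nhds ht] with s hs using (h.isMin hs).residual_v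
  exact (h1.congr_of_eventuallyEq h2.symm).unique (hasDerivAt_const t 0)

theorem inner_deriv_rest (h : IsLiftCurve γ M v ζ m J) {t : ℝ} (ht : t ∈ J)
    (w : EuclideanSpace 𝕜 (Fin (n + 1))) :
    inner 𝕜 (deriv (fun s => (M s).toLin (v s)) t) ((restPart M v t).toLin w) +
      inner 𝕜 ((M t).toLin (v t)) ((deriv (restPart M v) t).toLin w) = 0 := by
  have hu := (h.contDiff_M.toLin h.contDiff_v).hasDerivAt_of_isOpen h.isOpen ht
  have hB := hasDerivAt_toLin (h.contDiff_rest.hasDerivAt_of_isOpen h.isOpen ht)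
    (hasDerivAt_const t w)
  rw [map_zero, add_zero] at hB
  have h1 := hu.inner 𝕜 hB
  have h2 : (fun s => inner 𝕜 ((M s).toLin (v s)) ((restPart M v s).toLin w))
      =ᶠ[𝓝 t] fun _ => (0 : 𝕜) := by
    filter_upwards [h.isOpen.mem_nhds ht] with s hs using (h.isMin hs).inner_residual w
  rw [add_comm]
  exact (h1.congr_of_eventuallyEq h2.symm).unique (hasDerivAt_const t 0)

theorem norm_min (h : IsLiftCurve γ M v ζ m J) {t : ℝ} (ht : t ∈ J) : ‖minPart M v t‖ = 1 := by
  have h1 : ‖minPart M v t‖ ^ 2 = 1 := by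
    rw [minPart, norm_outer_sq, (h.isMin ht).norm_sq, (h.isMin ht).norm_eq]; norm_num
  exact (pow_eq_one_iff_of_nonneg (norm_nonneg _) two_ne_zero).1 h1

theorem inner_min_rest (h : IsLiftCurve γ M v ζ m J) {t : ℝ} (ht : t ∈ J) :
    inner 𝕜 (minPart M v t) (restPart M v t) = 0 := by
  rw [minPart, inner_outer, restPart, (h.isMin ht).residual_v, inner_zero_right]

/-- A' = u' v* + u v'*, and the two terms are orthogonal to B by B v = 0 and u*B = 0 respectively.
-/
theorem inner_deriv_min_rest (h : IsLiftCurve γ M v ζ m J) {t : ℝ} (ht : t ∈ J) :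
    inner 𝕜 (deriv (minPart M v) t) (restPart M v t) = 0 := by
  rw [h.deriv_min ht, inner_add_left, inner_outer, inner_outer, restPart, (h.isMin ht).residual_v,
    inner_zero_right, (h.isMin ht).inner_residual, add_zero]

theorem inner_min_deriv_rest (h : IsLiftCurve γ M v ζ m J) {t : ℝ} (ht : t ∈ J) :
    inner 𝕜 (minPart M v t) (deriv (restPart M v) t) = 0 := by
  rw [minPart, inner_outer, eq_neg_of_add_eq_zero_left (h.deriv_rest_v ht), inner_neg_right,
    restPart, (h.isMin ht).inner_residual, neg_zero]

theorem hasDerivAt_norm_sq {f : ℝ → Mat 𝕜 n} {f' : Mat 𝕜 n} {t : ℝ} (hf : HasDerivAt f f' t) :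
    HasDerivAt (fun s => ‖f s‖ ^ 2) (2 * RCLike.re (inner 𝕜 (f t) f')) t := by
  have h1 := (RCLike.reCLM (K := 𝕜)).hasFDerivAt.comp_hasDerivAt t (hf.inner 𝕜 hf)
  refine (h1.congr_of_eventuallyEq (Filter.Eventually.of_forall fun s => ?_)).congr_deriv ?_
  · exact (inner_self_eq_norm_sq (𝕜 := 𝕜) (f s)).symm
  · rw [RCLike.reCLM_apply, map_add, ← inner_conj_symm f' (f t), RCLike.conj_re, two_mul]

theorem re_inner_min_deriv (h : IsLiftCurve γ M v ζ m J) {t : ℝ} (ht : t ∈ J) :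
    RCLike.re (inner 𝕜 (minPart M v t) (deriv (minPart M v) t)) = 0 := by
  have h1 := hasDerivAt_norm_sq (h.contDiff_min.hasDerivAt_of_isOpen h.isOpen ht)
  have h2 : (fun s => ‖minPart M v s‖ ^ 2) =ᶠ[𝓝 t] fun _ => 1 := by
    filter_upwards [h.isOpen.mem_nhds ht] with s hs
    rw [h.norm_min hs, one_pow]
  have h3 := (h1.congr_of_eventuallyEq h2.symm).unique (hasDerivAt_const t 1)
  linarith

theorem condSq_eq (h : IsLiftCurve γ M v ζ m J) (hn : 1 ≤ n) {t : ℝ} (ht : t ∈ J) :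
    condSq 𝕜 n (γ t) = 1 + ‖restPart M v t‖ ^ 2 := by
  rw [(h.lift t ht).condSq_eq hn]
  have e : M t = minPart M v t + restPart M v t := by simp [minPart, restPart]
  rw [e, @norm_add_sq 𝕜, h.inner_min_rest ht, h.norm_min ht]
  simp

theorem deriv_log_condSq (h : IsLiftCurve γ M v ζ m J) (hn : 1 ≤ n) {t : ℝ} (ht : t ∈ J) :
    deriv (fun s => Real.log (condSq 𝕜 n (γ s))) t =
      2 * RCLike.re (inner 𝕜 (restPart M v t) (deriv (restPart M v) t)) /
        (1 + ‖restPart M v t‖ ^ 2) := by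
  have h1 := ((hasDerivAt_norm_sq (h.contDiff_rest.hasDerivAt_of_isOpen h.isOpen ht)).const_add
    1).log (by positivity)
  refine (h1.congr_of_eventuallyEq ?_).deriv
  filter_upwards [h.isOpen.mem_nhds ht] with s hs
  rw [h.condSq_eq hn hs]

/-- The parameters of the energy density of the variation. -/
def params (M : ℝ → Mat 𝕜 n) (v ζ : ℝ → EuclideanSpace 𝕜 (Fin (n + 1))) (a b t : ℝ) :
    Fin 11 → ℝ :=
  ![(t - a) * (b - t), a + b - 2 * t,
    ‖deriv (minPart M v) t‖ ^ 2,
    RCLike.re (inner 𝕜 (deriv (minPart M v) t) (deriv (restPart M v) t)),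
    ‖deriv (restPart M v) t‖ ^ 2,
    RCLike.re (inner 𝕜 (restPart M v t) (deriv (restPart M v) t)),
    ‖restPart M v t‖,
    ‖inner 𝕜 (minPart M v t) (deriv (minPart M v) t)‖ ^ 2,
    RCLike.re (starRingEnd 𝕜 (inner 𝕜 (minPart M v t) (deriv (minPart M v) t)) *
      inner 𝕜 (restPart M v t) (deriv (restPart M v) t)),
    ‖inner 𝕜 (restPart M v t) (deriv (restPart M v) t)‖ ^ 2,
    fubiniStudySq (ζ t) (deriv ζ t)]

theorem continuousOn_params (h : IsLiftCurve γ M v ζ m J) (a b : ℝ) :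
    ContinuousOn (params M v ζ a b) J := by
  have hA := h.contDiff_min.continuousOn
  have hB := h.contDiff_rest.continuousOn
  have hζ := h.contDiff_ζ.continuousOn
  have hA' := h.contDiff_min.continuousOn_deriv_of_isOpen h.isOpen (by norm_num)
  have hB' := h.contDiff_rest.continuousOn_deriv_of_isOpen h.isOpen (by norm_num)
  have hζ' := h.contDiff_ζ.continuousOn_deriv_of_isOpen h.isOpen (by norm_num)
  have hre : Continuous (RCLike.re : 𝕜 → ℝ) := RCLike.continuous_re
  have hAA' : ContinuousOn (fun t => inner 𝕜 (minPart M v t) (deriv (minPart M v) t)) J :=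
    hA.inner hA'
  have hBB' : ContinuousOn (fun t => inner 𝕜 (restPart M v t) (deriv (restPart M v) t)) J :=
    hB.inner hB'
  have hz : ContinuousOn (fun t => fubiniStudySq (ζ t) (deriv ζ t)) J :=
    (((hζ.norm.pow 2).mul (hζ'.norm.pow 2)).sub ((hζ.inner hζ').norm.pow 2)).div (hζ.norm.pow 4)
      fun t ht => pow_ne_zero 4 (norm_ne_zero_iff.2 (h.isMin ht).ne)
  refine continuousOn_pi.2 fun i => ?_
  fin_cases i
  · exact (by fun_prop : Continuous fun t : ℝ => (t - a) * (b - t)).continuousOn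
  · exact (by fun_prop : Continuous fun t : ℝ => a + b - 2 * t).continuousOn
  · exact hA'.norm.pow 2
  · exact hre.comp_continuousOn (hA'.inner hB')
  · exact hB'.norm.pow 2
  · exact hre.comp_continuousOn hBB'
  · exact hB.norm
  · exact hAA'.norm.pow 2
  · exact hre.comp_continuousOn ((RCLike.continuous_conj.comp_continuousOn hAA').mul hBB')
  · exact hBB'.norm.pow 2
  · exact hz

theorem second_variation_nonneg (h : IsLiftCurve γ M v ζ m J) {t : ℝ} (ht : t ∈ J) (a b : ℝ) :
    0 ≤ params M v ζ a b t 3 + params M v ζ a b t 4 -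
      2 * (params M v ζ a b t 8 + params M v ζ a b t 9) / (1 + params M v ζ a b t 6 ^ 2) +
      params M v ζ a b t 6 ^ 2 * (params M v ζ a b t 7 + 2 * params M v ζ a b t 8 +
        params M v ζ a b t 9) / (1 + params M v ζ a b t 6 ^ 2) ^ 2 +
      params M v ζ a b t 6 ^ 2 * params M v ζ a b t 10 := by
  change 0 ≤ RCLike.re (inner 𝕜 (deriv (minPart M v) t) (deriv (restPart M v) t)) +
    ‖deriv (restPart M v) t‖ ^ 2 -
    2 * (RCLike.re (starRingEnd 𝕜 (inner 𝕜 (minPart M v t) (deriv (minPart M v) t)) *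
      inner 𝕜 (restPart M v t) (deriv (restPart M v) t)) +
      ‖inner 𝕜 (restPart M v t) (deriv (restPart M v) t)‖ ^ 2) / (1 + ‖restPart M v t‖ ^ 2) +
    ‖restPart M v t‖ ^ 2 * (‖inner 𝕜 (minPart M v t) (deriv (minPart M v) t)‖ ^ 2 +
      2 * RCLike.re (starRingEnd 𝕜 (inner 𝕜 (minPart M v t) (deriv (minPart M v) t)) *
      inner 𝕜 (restPart M v t) (deriv (restPart M v) t)) +
      ‖inner 𝕜 (restPart M v t) (deriv (restPart M v) t)‖ ^ 2) / (1 + ‖restPart M v t‖ ^ 2) ^ 2 +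
    ‖restPart M v t‖ ^ 2 * fubiniStudySq (ζ t) (deriv ζ t)
  have hA'B := h.inner_deriv_min_rest ht
  have key := fun κ : 𝕜 => (h.isMin ht).second_variation_nonneg (h.deriv_rest_v ht)
    (h.inner_deriv_rest ht) κ
  rw [← h.deriv_min ht] at key
  change ∀ κ : 𝕜, 0 ≤ ‖deriv (restPart M v) t - κ • restPart M v t‖ ^ 2 + RCLike.re (inner 𝕜
    (deriv (minPart M v) t) (deriv (restPart M v) t - κ • restPart M v t)) at key
  generalize deriv (minPart M v) t = A' at *
  generalize deriv (restPart M v) t = B' at *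
  generalize minPart M v t = A at *
  generalize restPart M v t = B at *
  have hz := mul_nonneg (sq_nonneg ‖B‖) (fubiniStudySq_nonneg (ζ t) (deriv ζ t))
  set α : ℝ := 1 + ‖B‖ ^ 2 with hα
  have hα0 : α ≠ 0 := by positivity
  -- This κ is ⟨M, M'⟩ / ‖M‖², the mixed products being 0. It accounts for the radial part that the
  -- Fubini–Study metric discards.
  have k1 := key ((α⁻¹ : ℝ) * (inner 𝕜 A A' + inner 𝕜 B B'))
  have hn2 : ‖inner 𝕜 A A' + inner 𝕜 B B'‖ ^ 2 = ‖inner 𝕜 A A'‖ ^ 2 +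
      2 * RCLike.re (starRingEnd 𝕜 (inner 𝕜 A A') * inner 𝕜 B B') + ‖inner 𝕜 B B'‖ ^ 2 := by
    simp only [RCLike.norm_sq_eq_def, RCLike.mul_re, map_add, RCLike.conj_re, RCLike.conj_im]
    ring
  have hre : RCLike.re ((inner 𝕜 A A' + inner 𝕜 B B') * starRingEnd 𝕜 (inner 𝕜 B B')) =
      RCLike.re (starRingEnd 𝕜 (inner 𝕜 A A') * inner 𝕜 B B') + ‖inner 𝕜 B B'‖ ^ 2 := by
    simp only [RCLike.norm_sq_eq_def, RCLike.mul_re, map_add, RCLike.conj_re, RCLike.conj_im]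
    ring
  rw [@norm_sub_sq 𝕜, inner_smul_right, ← inner_conj_symm B' B, norm_smul, inner_sub_right,
    inner_smul_right, hA'B, mul_zero, sub_zero, mul_assoc, RCLike.re_ofReal_mul, hre, norm_mul,
    RCLike.norm_ofReal, mul_pow, mul_pow, sq_abs, hn2] at k1
  refine k1.trans ?_
  refine le_trans (le_of_eq ?_) (le_add_of_nonneg_right hz)
  field_simp
  ring

/-- The variation of the curve of matrices that scales the singular values other than the smallest
one. -/
def varied (M : ℝ → Mat 𝕜 n) (v : ℝ → EuclideanSpace 𝕜 (Fin (n + 1))) (a b s t : ℝ) : Mat 𝕜 n :=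
  minPart M v t + Real.exp (-(s * ((t - a) * (b - t)))) • restPart M v t

theorem hasDerivAt_varied (h : IsLiftCurve γ M v ζ m J) {t : ℝ} (ht : t ∈ J) (a b s : ℝ) :
    HasDerivAt (varied M v a b s) (deriv (minPart M v) t + Real.exp (-(s * ((t - a) * (b - t)))) •
      (deriv (restPart M v) t - (s * (a + b - 2 * t)) • restPart M v t)) t := by
  have hφ : HasDerivAt (fun t => Real.exp (-(s * ((t - a) * (b - t)))))
      (Real.exp (-(s * ((t - a) * (b - t)))) * -(s * (a + b - 2 * t))) t := by
    have h1 := ((hasDerivAt_id t).sub_const a).mul ((hasDerivAt_id t).const_sub b)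
    refine ((h1.const_mul s).neg.exp).congr_deriv ?_
    simp
    ring_nf
    simp
  refine ((h.contDiff_min.hasDerivAt_of_isOpen h.isOpen ht).add (hφ.smul
    (h.contDiff_rest.hasDerivAt_of_isOpen h.isOpen ht))).congr_deriv ?_
  module

theorem varied_facts (h : IsLiftCurve γ M v ζ m J) {t : ℝ} (ht : t ∈ J) (a b s : ℝ) :
    varied M v a b s t ≠ 0 ∧
    ‖varied M v a b s t‖ ^ 2 * (fubiniStudySq (varied M v a b s t)
      (deriv (varied M v a b s) t) + fubiniStudySq (ζ t) (deriv ζ t)) =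
      density s (params M v ζ a b t) := by
  obtain ⟨h1, h2⟩ := norm_sq_mul_fubiniStudySq (h.norm_min ht) (h.inner_min_rest ht)
    (h.inner_min_deriv_rest ht) (h.inner_deriv_min_rest ht) (h.re_inner_min_deriv ht)
    (Real.exp (-(s * ((t - a) * (b - t))))) (s * (a + b - 2 * t))
  refine ⟨fun h0 => ?_, ?_⟩
  · rw [varied] at h0
    rw [h0, norm_zero] at h1
    have : 0 ≤ Real.exp (-(s * ((t - a) * (b - t)))) ^ 2 * ‖restPart M v t‖ ^ 2 := by positivity
    norm_num at h1
    linarith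
  · rw [mul_add, (h.hasDerivAt_varied ht a b s).deriv]
    unfold varied
    rw [h2, h1]
    rfl

open Classical in
/-- The variation of the curve in the solution variety. -/
def variation (γ : ℝ → ℙ 𝕜 (Mat 𝕜 n) × ℙ 𝕜 (EuclideanSpace 𝕜 (Fin (n + 1))))
    (M : ℝ → Mat 𝕜 n) (v ζ : ℝ → EuclideanSpace 𝕜 (Fin (n + 1))) (a b s t : ℝ) :
    ℙ 𝕜 (Mat 𝕜 n) × ℙ 𝕜 (EuclideanSpace 𝕜 (Fin (n + 1))) :=
  -- The second branch is a filler: over J both vectors are nonzero.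
  if h : varied M v a b s t ≠ 0 ∧ ζ t ≠ 0 then
    (Projectivization.mk 𝕜 (varied M v a b s t) h.1, Projectivization.mk 𝕜 (ζ t) h.2) else γ t

theorem variation_eq (h : IsLiftCurve γ M v ζ m J) {t : ℝ} (ht : t ∈ J) (a b s : ℝ) :
    ∃ (h1 : varied M v a b s t ≠ 0) (h2 : ζ t ≠ 0), variation γ M v ζ a b s t =
      (Projectivization.mk 𝕜 (varied M v a b s t) h1, Projectivization.mk 𝕜 (ζ t) h2) :=
  ⟨(h.varied_facts ht a b s).1, (h.isMin ht).ne, by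
    rw [variation, dif_pos ⟨(h.varied_facts ht a b s).1, (h.isMin ht).ne⟩]⟩

theorem variation_eq_self (h : IsLiftCurve γ M v ζ m J) {a b s t : ℝ} (ht : t ∈ J)
    (h0 : s * ((t - a) * (b - t)) = 0) : variation γ M v ζ a b s t = γ t := by
  obtain ⟨h1, h2, e⟩ := h.variation_eq ht a b s
  obtain ⟨⟨h3, h4, e'⟩, -⟩ := h.lift t ht
  have hM : varied M v a b s t = M t := by
    rw [varied, h0]
    simp [minPart, restPart]
  rw [e, e']
  simp only [hM]

/-- The bound on s is exp(-sφ)² m > 1 in logarithmic form: the rescaled singular values stay above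
1. -/
theorem isMin_varied (h : IsLiftCurve γ M v ζ m J) {a b s t : ℝ} (ht : t ∈ J)
    (hm : 2 * (s * ((t - a) * (b - t))) < Real.log m) :
    IsMinSingular (varied M v a b s t) (v t) (ζ t) 1
      (Real.exp (-(s * ((t - a) * (b - t)))) ^ 2 * m) := by
  refine (h.isMin ht).scale ?_
  have hm0 : 0 < m := one_pos.trans (h.isMin ht).lt
  calc 1 < Real.exp (2 * -(s * ((t - a) * (b - t))) + Real.log m) :=
        Real.one_lt_exp_iff.2 (by linarith)
    _ = Real.exp (-(s * ((t - a) * (b - t)))) ^ 2 * m := by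
        rw [Real.exp_add, Real.exp_log hm0, ← Real.exp_nat_mul]
        norm_num

theorem integrand_variation (h : IsLiftCurve γ M v ζ m J) (hn : 1 ≤ n) {a b s t : ℝ} (ht : t ∈ J)
    (hm : 2 * (s * ((t - a) * (b - t))) < Real.log m) :
    condSq 𝕜 n (variation γ M v ζ a b s t) *
      (speedSq (fun τ => (variation γ M v ζ a b s τ).1) t +
        speedSq (fun τ => (variation γ M v ζ a b s τ).2) t) =
      density s (params M v ζ a b t) := by
  obtain ⟨h1, h2, e⟩ := h.variation_eq ht a b s
  have s1 := speedSq_eq (fun τ => (variation γ M v ζ a b s τ).1) t (varied M v a b s) _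
    (h.hasDerivAt_varied ht a b s) (by
      filter_upwards [h.isOpen.mem_nhds ht] with τ hτ
      obtain ⟨h1, h2, e⟩ := h.variation_eq hτ a b s
      exact ⟨h1, congrArg Prod.fst e⟩)
  have s2 := speedSq_eq (fun τ => (variation γ M v ζ a b s τ).2) t ζ _
    (h.contDiff_ζ.hasDerivAt_of_isOpen h.isOpen ht) (by
      filter_upwards [h.isOpen.mem_nhds ht] with τ hτ
      obtain ⟨h1, h2, e⟩ := h.variation_eq hτ a b s
      exact ⟨h2, congrArg Prod.snd e⟩)
  rw [s1, s2, e, (h.isMin_varied ht hm).condSq_mk_eq hn h1,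
    ← (h.hasDerivAt_varied ht a b s).deriv, (h.varied_facts ht a b s).2]

theorem exists_isVariation (h : IsLiftCurve γ M v ζ m J) (hn : 1 ≤ n) {a b : ℝ} (hab : a < b)
    (hJ : Set.Icc a b ⊆ J) : ∃ δ > 0,
      (∀ s ∈ Set.Ioo (-δ) δ, ∀ t ∈ Set.Icc a b, 2 * (s * ((t - a) * (b - t))) < Real.log m) ∧
      IsVariation (solutionVariety 𝕜 n) γ a b δ (variation γ M v ζ a b) := by
  have hm1 : 1 < m := (h.isMin (hJ (Set.left_mem_Icc.2 hab.le))).lt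
  have hlog : 0 < Real.log m := Real.log_pos hm1
  set K : ℝ := (b - a) ^ 2 with hK
  have hK0 : 0 < K := by have := sub_pos.2 hab; positivity
  -- K = (b - a)² bounds φ on [a, b], so |s| < log m / (2K) ensures 2sφ < log m.
  have hδ : 0 < Real.log m / (2 * K) := by positivity
  have hsmall : ∀ s ∈ Set.Ioo (-(Real.log m / (2 * K))) (Real.log m / (2 * K)),
      ∀ t ∈ Set.Icc a b, 2 * (s * ((t - a) * (b - t))) < Real.log m := by
    rintro s ⟨-, hs⟩ t ⟨hta, htb⟩
    have hφ : 0 ≤ (t - a) * (b - t) := mul_nonneg (by linarith) (by linarith)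
    have hφK : (t - a) * (b - t) ≤ K := by rw [hK]; nlinarith
    rcases le_or_gt s 0 with h0 | h0
    · nlinarith [mul_nonneg (neg_nonneg.2 h0) hφ]
    · rw [lt_div_iff₀ (by positivity)] at hs
      nlinarith [mul_le_mul_of_nonneg_left hφK h0.le]
  refine ⟨_, hδ, hsmall, ⟨?_, ?_⟩, ?_, ?_, ?_, ?_⟩
  · intro p hp
    refine ⟨Set.univ, Filter.univ_mem, fun q => varied M v a b q.1 q.2, ?_, fun q hq => ?_⟩
    · have hmaps : Set.MapsTo (Prod.snd : ℝ × ℝ → ℝ)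
        (Set.Ioo (-(Real.log m / (2 * K))) (Real.log m / (2 * K)) ×ˢ Set.Icc a b ∩ Set.univ) J :=
        fun q hq => hJ hq.1.2
      have hA := h.contDiff_min.comp contDiff_snd.contDiffOn hmaps
      have hB := h.contDiff_rest.comp contDiff_snd.contDiffOn hmaps
      have hc : ContDiff ℝ 2 fun q : ℝ × ℝ =>
        Real.exp (-(q.1 * ((q.2 - a) * (b - q.2)))) := by fun_prop
      exact hA.add (hc.contDiffOn.smul hB)
    · obtain ⟨h1, h2, e⟩ := h.variation_eq (hJ hq.1.2) a b q.1
      exact ⟨h1, congrArg Prod.fst e⟩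
  · intro p hp
    refine ⟨Set.univ, Filter.univ_mem, fun q => ζ q.2, ?_, fun q hq => ?_⟩
    · exact h.contDiff_ζ.comp contDiff_snd.contDiffOn fun q hq => hJ hq.1.2
    · obtain ⟨h1, h2, e⟩ := h.variation_eq (hJ hq.1.2) a b q.1
      exact ⟨h2, congrArg Prod.snd e⟩
  · intro s hs t ht
    obtain ⟨h1, h2, e⟩ := h.variation_eq (hJ ht) a b s
    rw [e]
    exact (h.isMin_varied (hJ ht) (hsmall s hs t ht)).mk_mem hn h1 h2
  · exact fun t ht => h.variation_eq_self (hJ ht) (by ring)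
  · exact fun s _ => h.variation_eq_self (hJ (Set.left_mem_Icc.2 hab.le)) (by ring)
  · exact fun s _ => h.variation_eq_self (hJ (Set.right_mem_Icc.2 hab.le)) (by ring)

/-- Criticality makes the integral of -2φQ - φ'(log α₂)' vanish, and φ and Q are nonnegative on [a,
b]. -/
theorem integral_deriv_log_nonpos (h : IsLiftCurve γ M v ζ m J) (hn : 1 ≤ n) {a b : ℝ}
    (hab : a < b) (hJ : Set.Icc a b ⊆ J)
    (hcrit : ∀ δ > 0, ∀ Γ, IsVariation (solutionVariety 𝕜 n) γ a b δ Γ →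
      HasDerivAt (fun s => energy (condSq 𝕜 n) (Γ s) a b) 0 0) :
    ∫ t in a..b, (a + b - 2 * t) * deriv (fun s => Real.log (condSq 𝕜 n (γ s))) t ≤ 0 := by
  obtain ⟨δ, hδ, hsmall, hvar⟩ := h.exists_isVariation hn hab hJ
  have hk := (h.continuousOn_params a b).mono hJ
  obtain ⟨hgi, hE⟩ := hasDerivAt_integral_of_contDiff contDiff_density hab.le hk
    fun t => hasDerivAt_density (params M v ζ a b t)
  have hu : Set.uIcc a b = Set.Icc a b := Set.uIcc_of_le hab.le
  have hEq : (fun s => energy (condSq 𝕜 n) (variation γ M v ζ a b s) a b) =ᶠ[𝓝 0]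
      fun s => 1 / 2 * ∫ t in a..b, density s (params M v ζ a b t) := by
    filter_upwards [Ioo_mem_nhds (neg_lt_zero.2 hδ) hδ] with s hs
    rw [energy]
    congr 1
    refine intervalIntegral.integral_congr fun t ht => ?_
    rw [hu] at ht
    exact h.integrand_variation hn (hJ ht) (hsmall s hs t ht)
  have h0 := ((hE.const_mul (1 / 2)).congr_of_eventuallyEq hEq).unique (hcrit δ hδ _ hvar)
  have hcong : ∫ t in a..b, (a + b - 2 * t) * deriv (fun s => Real.log (condSq 𝕜 n (γ s))) t =
      ∫ t in a..b, params M v ζ a b t 1 *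
        (2 * params M v ζ a b t 5 / (1 + params M v ζ a b t 6 ^ 2)) := by
    refine intervalIntegral.integral_congr fun t ht => ?_
    rw [hu] at ht
    rw [h.deriv_log_condSq hn (hJ ht)]
    rfl
  have hki := fun i => continuousOn_pi.1 hk i
  have hfi : IntervalIntegrable (fun t => params M v ζ a b t 1 *
      (2 * params M v ζ a b t 5 / (1 + params M v ζ a b t 6 ^ 2))) MeasureTheory.volume a b :=
    ((hki 1).mul ((continuousOn_const.mul (hki 5)).div (continuousOn_const.add ((hki 6).pow 2))
      fun t _ => show 1 + params M v ζ a b t 6 ^ 2 ≠ 0 by positivity)).intervalIntegrable_of_Icc hab.le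
  have hle := intervalIntegral.integral_mono_on hab.le hfi hgi.neg fun t ht => by
    have h1 := h.second_variation_nonneg (hJ ht) a b
    have h2 : 0 ≤ params M v ζ a b t 0 :=
      mul_nonneg (sub_nonneg.2 ht.1) (sub_nonneg.2 ht.2)
    have h3 := mul_nonneg (mul_nonneg zero_le_two h2) h1
    rw [Pi.neg_apply]
    linarith
  simp only [Pi.neg_apply] at hle
  rw [intervalIntegral.integral_neg] at hle
  rw [hcong]
  linarith

end IsLiftCurve

/-- The second derivative is tested only in the interior of I, where lifts live on open sets;
continuity covers the end points. -/
theorem IsGeodesicOn.convexOn_log_condSq (hn : 1 ≤ n)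
    {γ : ℝ → ℙ 𝕜 (Mat 𝕜 n) × ℙ 𝕜 (EuclideanSpace 𝕜 (Fin (n + 1)))} {I : Set ℝ}
    (h : IsGeodesicOn (solutionVariety 𝕜 n) (condSq 𝕜 n) γ I) :
    ConvexOn ℝ I fun t => Real.log (condSq 𝕜 n (γ t)) := by
  have hf : ContDiffOn ℝ 2 (fun t => Real.log (condSq 𝕜 n (γ t))) I :=
    (contDiffOn_condSq hn h.contDiff h.mem).log fun t ht => (condSq_pos (h.mem t ht)).ne'
  have hfi := hf.mono interior_subset
  have hd : DifferentiableOn ℝ (deriv fun t => Real.log (condSq 𝕜 n (γ t))) (interior I) :=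
    (hfi.deriv_of_isOpen (m := 1) isOpen_interior (by norm_num)).differentiableOn (by norm_num)
  refine convexOn_of_deriv2_nonneg h.interval.convex hf.continuousOn
    (hfi.differentiableOn (by norm_num)) hd fun t₀ ht₀ => ?_
  obtain ⟨U, hU, M, v, ζ, m, hM, hv, hζ, hl⟩ :=
    exists_isLift hn h.contDiff h.mem (interior_subset ht₀)
  have hJI : interior I ∩ interior U ⊆ I ∩ U :=
    Set.inter_subset_inter interior_subset interior_subset
  have hL : IsLiftCurve γ M v ζ m (interior I ∩ interior U) :=
    ⟨isOpen_interior.inter isOpen_interior, hM.mono hJI, hv.mono hJI, hζ.mono hJI,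
      fun t ht => hl t (hJI ht)⟩
  have hdt := (hd.differentiableAt (isOpen_interior.mem_nhds ht₀)).hasDerivAt
  refine nonneg_of_integral_nonpos (hL.isOpen.mem_nhds ⟨ht₀, mem_interior_iff_mem_nhds.2 hU⟩) hdt
    (hd.continuousOn.mono Set.inter_subset_left) fun r hr hsub => ?_
  have hlt : t₀ - r < t₀ + r := by linarith
  exact hL.integral_deriv_log_nonpos hn hlt hsub fun δ hδ Γ hΓ =>
    h.critical _ (interior_subset (hsub (Set.left_mem_Icc.2 hlt.le)).1) _
      (interior_subset (hsub (Set.right_mem_Icc.2 hlt.le)).1) hlt δ hδ Γ hΓ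

end Geodesics

end CondMetric

end

theorem corollary4 {𝕜 : Type*} [RCLike 𝕜] (n : ℕ) (hn : 1 ≤ n) :
    CondMetric.IsSelfConvexOn (CondMetric.solutionVariety 𝕜 n) (CondMetric.condSq 𝕜 n) :=
  ⟨fun _ _ _ _ hφ hW => CondMetric.contDiffOn_condSq hn hφ hW,
    fun _ hp => CondMetric.condSq_pos hp, fun _ _ h => h.convexOn_log_condSq hn⟩
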